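/- Let $\Sigma$ be a compact smooth Riemannian manifold (without boundary). Let the torus $\mathbb T^N=\mathbb R^N/(2\pi\mathbb Z)^N$ act smoothly on $\Sigma$ by isometries, and let $\psi_1,\dots,\psi_N$ be the generating Killing fields, i.e. the flow of $\psi_i$ is the action of the $i$-th circle factor (so the $\psi_i$ commute and their orbits close after $2\pi$). Let $\underline\Omega=(\Omega_1,\dots,\Omega_N)\in\mathbb R^N$, let $s=\sum_{i=1}^N\Omega_i\psi_i$, and let $\hat\phi_\tau$ be the flow of the Killing field $s$. Assume that $\underline\Omega$ satisfies the diophantine condition: there is a real number $q$ such that $$|\underline\Omega\cdot\underline m|>|\underline\Omega|\,|\underline m|^{-q}$$ for all but finitely many $\underline m\in\mathbb Z^N$, where $|\cdot|$ is the Euclidean norm. Let $J:\Sigma\to\mathbb R$ be a smooth function such that $$\lim_{T\to\infty}\frac1T\int_0^T J(\hat\phi_\tau(x))\,d\tau=0\qquad\text{for every }x\in\Sigma.$$ Then the equation $\mathcal L_s h=J$ has a smooth solution $h:\Sigma\to\mathbb R$. If moreover $\Sigma$ and its metric are real analytic and $J$ is real analytic, then $\mathcal L_s h=J$ has a real analytic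 solution $h$. -/

import Mathlib

open Filter Topology MeasureTheory Manifold Bundle
open scoped ContDiff Real

/-- The Lie derivative `£_X h = X(h)` of a real function `h` along the vector field `X`. -/
noncomputable def lieDerivative {d : ℕ} {M : Type*} [TopologicalSpace M]
    [ChartedSpace (EuclideanSpace ℝ (Fin d)) M]
    (X : ∀ x : M, TangentSpace (𝓡 d) x) (h : M → ℝ) (x : M) : ℝ :=
  mfderiv (𝓡 d) 𝓘(ℝ, ℝ) h x (X x)

/-- `φ` is the global flow of the vector field `X`: for every `x`, the curve `t ↦ φ t x` is the
integral curve of `X` starting at `x`. -/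
structure IsFlowOf {d : ℕ} {M : Type*} [TopologicalSpace M]
    [ChartedSpace (EuclideanSpace ℝ (Fin d)) M]
    (φ : ℝ → M → M) (X : ∀ x : M, TangentSpace (𝓡 d) x) : Prop where
  map_zero : ∀ x, φ 0 x = x
  isMIntegralCurve : ∀ x, IsMIntegralCurve (I := 𝓡 d) (fun t => φ t x) X

/-- `Φ` is a smooth isometric action on the Riemannian manifold `M` of the torus
`𝕋ᴺ = ℝᴺ / (2πℤ)ᴺ`, written as an action of `ℝᴺ` that is `2π`-periodic in each coordinate. -/
structure IsIsometricTorusAction (d N : ℕ) {M : Type*} [TopologicalSpace M]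
    [ChartedSpace (EuclideanSpace ℝ (Fin d)) M]
    [RiemannianBundle (fun x : M => TangentSpace (𝓡 d) x)]
    (Φ : EuclideanSpace ℝ (Fin N) → M → M) : Prop where
  map_zero : ∀ x, Φ 0 x = x
  map_add : ∀ σ τ x, Φ (σ + τ) x = Φ σ (Φ τ x)
  periodic : ∀ (i : Fin N) (x : M), Φ (EuclideanSpace.single i (2 * π)) x = x
  contMDiff : ContMDiff ((𝓡 N).prod (𝓡 d)) (𝓡 d) ∞
    (fun p : EuclideanSpace ℝ (Fin N) × M => Φ p.1 p.2)
  isometry : ∀ (τ : EuclideanSpace ℝ (Fin N)) (x : M) (v w : TangentSpace (𝓡 d) x),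
    inner ℝ (mfderiv (𝓡 d) (𝓡 d) (Φ τ) x v) (mfderiv (𝓡 d) (𝓡 d) (Φ τ) x w) = inner ℝ v w

/-- The diophantine condition: there is a real number `q` such that `|Ω · m| > |Ω| |m| ^ (-q)`
for all but finitely many `m ∈ ℤᴺ`; `|·|` is the Euclidean norm. -/
def IsDiophantine {N : ℕ} (Ω : EuclideanSpace ℝ (Fin N)) : Prop :=
  ∃ q : ℝ, ∀ᶠ m : Fin N → ℤ in cofinite,
    |∑ i, Ω i * (m i : ℝ)| > ‖Ω‖ * ‖(WithLp.toLp 2 (fun i => (m i : ℝ)) :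
      EuclideanSpace ℝ (Fin N))‖ ^ (-q)

/-!
Along the orbit of a point `x`, the function `J` is a smooth function `f` on the torus, and the
equation `£_s h = J` becomes the cohomological equation `Ω · ∂h = f` there. Expanding in Fourier
series, one has to divide the coefficient at `m` by `i Ω · m`. The diophantine condition bounds
the inverses of these divisors by a power of the multiplier of the operator `A = ∏ (1 - ∂ᵢ²)`, so
that the solution is `∫ K · Aᵏ f` over the torus, with a single continuous kernel `K` that depends
on neither `f` nor `x` (`IsDiophantine.exists_kernel`), provided that `f` has mean zero. The mean
value vanishes by the hypothesis on the time averages: the difference of `J` and its mean value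
over the orbit has a bounded primitive along the flow
(`IsIsometricTorusAction.mFourierCoeff_zero_eq_zero`).

Hence `h x = ∫ K(t) (Aᵏ J)(t · x) dt` solves the equation, `Aᵏ` acting in the torus variable `t`,
and what remains is its regularity in `x`. In the smooth case, the integrand is smooth in
`(t, x)`. In the analytic case, the difficulty is that the action is only assumed to be smooth.
However, isometries `φ` of analytic metrics satisfy an analytic total differential equation for
the pair `(φ, Dφ)`, by Koszul's formula for the Levi-Civita connection
(`hasFDerivAt_of_isometry`), and solutions of such an equation are analytic functions of the
position and of the initial value (`AnalyticAt.exists_solution_map`). So, in charts,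
`t · x = Y (p t, x)`, where `Y` is analytic and the `1`-jet `p` of the isometry at the centre of
the chart is smooth in `t` (`exists_analyticAt_of_isometry_family`).

Functions of the form `W (p t, x)` with `p` smooth and `W` of class `C^n`, where `n` is `∞` or
`ω`, are the subject of `FactorsAt`. They are stable under differentiation in `t`, and their
integrals over `t` are of class `C^n` in `x` (`FactorsAt.contDiffAt_setIntegral`). For `n = ω`,
the latter and the solution of the total differential equation rest on the analyticity of
superposition operators on spaces of continuous functions
(`HasFPowerSeriesOnBall.exists_superposition`), together with the analytic implicit function
theorem in Banach spaces.
-/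

/-! ### Superposition operators and integrals depending on a parameter -/

namespace FormalMultilinearSeries

variable {S E G : Type*} [TopologicalSpace S] [CompactSpace S]
  [NormedAddCommGroup E] [NormedSpace ℝ E] [NormedAddCommGroup G] [NormedSpace ℝ G]

/-- The pointwise extension of a formal multilinear series to spaces of continuous functions on a
compact space: its `n`-th term sends `(u₁, …, uₙ)` to `s ↦ pₙ (u₁ s, …, uₙ s)`. -/
noncomputable def pointwise (S : Type*) [TopologicalSpace S] [CompactSpace S]
    (p : FormalMultilinearSeries ℝ E G) :
    FormalMultilinearSeries ℝ C(S, E) C(S, G) := fun n =>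
  MultilinearMap.mkContinuous
    { toFun := fun u => ⟨fun s => p n (fun i => u i s), by fun_prop⟩
      map_update_add' := by
        intro _ u i a b
        ext s
        have key : ∀ c : C(S, E), (fun j => (Function.update u i c) j s)
            = Function.update (fun j => u j s) i (c s) := fun c => by
          ext j; by_cases h : j = i
          · subst h; simp
          · simp [h]
        simp [key]
      map_update_smul' := by
        intro _ u i a b
        ext s
        have key : ∀ c : C(S, E), (fun j => (Function.update u i c) j s)
            = Function.update (fun j => u j s) i (c s) := fun c => by
          ext j; by_cases h : j = i
          · subst h; simp
          · simp [h]
        simp [key] }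
    ‖p n‖ (fun u => by
      refine (ContinuousMap.norm_le _ (by positivity)).2 fun s => ?_
      refine ((p n).le_opNorm _).trans ?_
      gcongr with i
      exact (u i).norm_coe_le_norm s)

theorem norm_pointwise_le (p : FormalMultilinearSeries ℝ E G) (n : ℕ) :
    ‖p.pointwise S n‖ ≤ ‖p n‖ :=
  MultilinearMap.mkContinuous_norm_le _ (norm_nonneg _) _

theorem radius_le_radius_pointwise (p : FormalMultilinearSeries ℝ E G) :
    p.radius ≤ (p.pointwise S).radius :=
  radius_le_of_le fun n => norm_pointwise_le p n

end FormalMultilinearSeries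

section Superposition

variable {S E G : Type*} [TopologicalSpace S] [CompactSpace S]
  [NormedAddCommGroup E] [NormedSpace ℝ E] [NormedAddCommGroup G] [NormedSpace ℝ G]
  [CompleteSpace G]

/-- Near a constant function, the superposition operator `u ↦ W ∘ u` of an analytic map `W` is
analytic on the continuous functions on a compact space. The operator is given by the sum of the
pointwise power series, since `W ∘ u` need not be continuous for other `u`. -/
theorem HasFPowerSeriesOnBall.exists_superposition {W : E → G}
    {p : FormalMultilinearSeries ℝ E G} {e : E} {r : ENNReal} (h : HasFPowerSeriesOnBall W p e r) :
    ∃ Φ : C(S, E) → C(S, G),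
      AnalyticOnNhd ℝ Φ (Metric.eball (ContinuousMap.const S e) r) ∧
      ∀ u ∈ Metric.eball (ContinuousMap.const S e) r, ∀ s, Φ u s = W (u s) := by
  have hr : 0 < (p.pointwise S).radius :=
    h.r_pos.trans_le (h.r_le.trans p.radius_le_radius_pointwise)
  have hP := (p.pointwise S).hasFPowerSeriesOnBall hr
  refine ⟨fun u => (p.pointwise S).sum (u - ContinuousMap.const S e), fun u hu => ?_,
    fun u hu s => ?_⟩
  · have hu' : u - ContinuousMap.const S e ∈ Metric.eball (0 : C(S, E)) (p.pointwise S).radius := by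
      rw [Metric.mem_eball, edist_zero_right, ← edist_eq_enorm_sub]
      exact (Metric.mem_eball.1 hu).trans_le (h.r_le.trans p.radius_le_radius_pointwise)
    exact AnalyticAt.fun_comp (hP.analyticOnNhd _ hu') (by fun_prop)
  · have hu' : u - ContinuousMap.const S e ∈ Metric.eball (0 : C(S, E)) (p.pointwise S).radius := by
      rw [Metric.mem_eball, edist_zero_right, ← edist_eq_enorm_sub]
      exact (Metric.mem_eball.1 hu).trans_le (h.r_le.trans p.radius_le_radius_pointwise)
    have h1 := (ContinuousMap.evalCLM ℝ s).hasSum ((p.pointwise S).hasSum hu')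
    have h2 : u s - e ∈ Metric.eball (0 : E) r := by
      rw [Metric.mem_eball, edist_zero_right, ← edist_eq_enorm_sub]
      refine lt_of_le_of_lt ?_ (Metric.mem_eball.1 hu)
      rw [edist_dist, edist_dist]
      exact ENNReal.ofReal_le_ofReal (ContinuousMap.dist_apply_le_dist (f := u) (g := .const S e) s)
    have h3 := h.hasSum h2
    simp only [add_sub_cancel] at h3
    exact h1.unique h3

end Superposition

section ParametricIntegral

variable {S : Type} [MeasurableSpace S] {ν : Measure S} [IsFiniteMeasure ν]

/-- Differentiation under the integral sign when the integrand depends on the integration variable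
only through a bounded measurable parameter `p`: no continuity of `p` is needed. -/
theorem contDiffOn_integral_of_measurable_param (n : ℕ) {P E : Type}
    [NormedAddCommGroup P] [NormedSpace ℝ P] [FiniteDimensional ℝ P] [MeasurableSpace P]
    [BorelSpace P] [NormedAddCommGroup E] [NormedSpace ℝ E] [FiniteDimensional ℝ E]
    {p₀ : P} {v₀ : E} {r : ℝ} {p : S → P} (hp : Measurable p)
    {ρ : ℝ} (hρ : ρ < r) (hpρ : ∀ s, p s ∈ Metric.closedBall p₀ ρ) :
    ∀ {G : Type} [NormedAddCommGroup G] [NormedSpace ℝ G]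
    {W : P × E → G}, ContDiffOn ℝ n W (Metric.ball p₀ r ×ˢ Metric.ball v₀ r) →
    ContDiffOn ℝ n (fun v => ∫ s, W (p s, v) ∂ν) (Metric.ball v₀ r) := by
  have hsub : Metric.closedBall p₀ ρ ⊆ Metric.ball p₀ r := Metric.closedBall_subset_ball hρ
  have bound : ∀ {G : Type} [NormedAddCommGroup G] {W : P × E → G} {R : ℝ}, R < r →
      ContinuousOn W (Metric.ball p₀ r ×ˢ Metric.ball v₀ r) →
      ∃ C, ∀ s, ∀ v ∈ Metric.closedBall v₀ R, ‖W (p s, v)‖ ≤ C := by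
    intro G _ W R hR hW
    have := FiniteDimensional.proper_real P
    have := FiniteDimensional.proper_real E
    obtain ⟨C, hC⟩ := ((isCompact_closedBall p₀ ρ).prod
      (isCompact_closedBall v₀ R)).exists_bound_of_continuousOn (hW.mono
        (Set.prod_mono hsub (Metric.closedBall_subset_ball hR)))
    exact ⟨C, fun s v hv => hC _ ⟨hpρ s, hv⟩⟩
  have meas : ∀ {G : Type} [NormedAddCommGroup G] {W : P × E → G},
      ContinuousOn W (Metric.ball p₀ r ×ˢ Metric.ball v₀ r) → ∀ v ∈ Metric.ball v₀ r,
      AEStronglyMeasurable (fun s => W (p s, v)) ν := by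
    intro G _ W hW v hv
    have h1 : ContinuousOn (fun q => W (q, v)) (Metric.closedBall p₀ ρ) :=
      hW.comp (by fun_prop) fun q hq => ⟨hsub hq, hv⟩
    have := FiniteDimensional.proper_real P
    have h2 := (h1.aestronglyMeasurable (μ := ν.map p) Metric.isClosed_closedBall.measurableSet)
    have h3 : (ν.map p).restrict (Metric.closedBall p₀ ρ) = ν.map p := by
      rw [Measure.restrict_eq_self_of_ae_mem]
      exact (ae_map_iff hp.aemeasurable
        (p := fun q => q ∈ Metric.closedBall p₀ ρ) Metric.isClosed_closedBall.measurableSet).2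
        (ae_of_all _ hpρ)
    rw [h3] at h2
    exact h2.comp_measurable hp
  have nhd : ∀ v ∈ Metric.ball v₀ r, ∃ R < r, Metric.closedBall v₀ R ∈ 𝓝 v := by
    intro v hv
    obtain ⟨R, h1, h2⟩ := exists_between (Metric.mem_ball.1 hv)
    exact ⟨R, h2, mem_of_superset (Metric.isOpen_ball.mem_nhds (Metric.mem_ball.2 h1))
      Metric.ball_subset_closedBall⟩
  have opn : IsOpen (Metric.ball p₀ r ×ˢ Metric.ball v₀ r) :=
    Metric.isOpen_ball.prod Metric.isOpen_ball
  induction n with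
  | zero =>
    intro G _ _ W hW
    rw [Nat.cast_zero, contDiffOn_zero] at hW ⊢
    intro v hv
    obtain ⟨R, hR, hRv⟩ := nhd v hv
    obtain ⟨C, hC⟩ := bound hR hW
    refine (continuousAt_of_dominated (bound := fun _ => C) ?_ ?_ (integrable_const C)
      ?_).continuousWithinAt
    · filter_upwards [Metric.isOpen_ball.mem_nhds hv] with w hw using meas hW w hw
    · filter_upwards [hRv] with w hw using ae_of_all _ fun s => hC s w hw
    · refine ae_of_all _ fun s => ?_
      exact (hW.continuousAt (opn.mem_nhds ⟨hsub (hpρ s), hv⟩)).comp (f := fun v => (p s, v))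
        (by fun_prop)
  | succ n ih =>
    intro G _ _ W hW
    rw [Nat.cast_succ, contDiffOn_succ_iff_fderiv_of_isOpen Metric.isOpen_ball]
    have hW' : ContDiffOn ℝ n (fun z => (fderiv ℝ W z).comp (ContinuousLinearMap.inr ℝ P E))
        (Metric.ball p₀ r ×ˢ Metric.ball v₀ r) := by
      rw [Nat.cast_succ, contDiffOn_succ_iff_fderiv_of_isOpen opn] at hW
      exact hW.2.2.clm_comp contDiffOn_const
    have key : ∀ v ∈ Metric.ball v₀ r, HasFDerivAt (fun v => ∫ s, W (p s, v) ∂ν)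
        (∫ s, (fderiv ℝ W (p s, v)).comp (ContinuousLinearMap.inr ℝ P E) ∂ν) v := by
      intro v hv
      obtain ⟨R, hR, hRv⟩ := nhd v hv
      obtain ⟨C, hC⟩ := bound hR hW'.continuousOn
      obtain ⟨C', hC'⟩ := bound hR hW.continuousOn
      refine hasFDerivAt_integral_of_dominated_of_fderiv_le (s := Metric.closedBall v₀ R)
        (bound := fun _ => C) (F := fun v s => W (p s, v))
        (F' := fun v s => (fderiv ℝ W (p s, v)).comp (ContinuousLinearMap.inr ℝ P E)) hRv ?_ ?_ ?_
        ?_ (integrable_const C) ?_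
      · filter_upwards [Metric.isOpen_ball.mem_nhds hv] with w hw using meas hW.continuousOn w hw
      · exact Integrable.of_bound (meas hW.continuousOn v hv) C'
          (ae_of_all _ fun s => hC' s v (mem_of_mem_nhds hRv))
      · exact meas hW'.continuousOn v hv
      · exact ae_of_all _ fun s w hw => hC s w hw
      · refine ae_of_all _ fun s w hw => ?_
        have hd : DifferentiableAt ℝ W (p s, w) :=
          (hW.contDiffAt (opn.mem_nhds
            ⟨hsub (hpρ s), Metric.closedBall_subset_ball hR hw⟩)).differentiableAt (by simp)
        exact hd.hasFDerivAt.comp (f := fun w => (p s, w)) w (hasFDerivAt_prodMk_right (p s) w)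
    refine ⟨fun v hv => (key v hv).differentiableAt.differentiableWithinAt, by simp, ?_⟩
    exact (ih hW').congr fun v hv => (key v hv).fderiv

/-- Integrals of `v ↦ W (p s, v)` over `s` inherit the regularity of `W`, smooth or analytic, as
soon as `p` takes its values in a sufficiently small ball, whose radius does not depend on `p`. In
the analytic case the integral is a continuous linear functional of a superposition operator,
applied to the affine map that sends `v` to the function `q ↦ (q, v)` on this ball. -/
theorem ContDiffOn.exists_contDiffAt_integral {n : WithTop ℕ∞} (hn : n = ∞ ∨ n = ω)
    {P E G : Type}
    [NormedAddCommGroup P] [NormedSpace ℝ P] [FiniteDimensional ℝ P] [MeasurableSpace P]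
    [BorelSpace P] [NormedAddCommGroup E] [NormedSpace ℝ E] [FiniteDimensional ℝ E]
    [NormedAddCommGroup G] [NormedSpace ℝ G] [CompleteSpace G]
    {p₀ : P} {v₀ : E} {W : P × E → G} {U : Set (P × E)} (hU : U ∈ 𝓝 (p₀, v₀))
    (hW : ContDiffOn ℝ n W U) :
    ∃ ε > 0, ∀ {S : Type} [MeasurableSpace S] (ν : Measure S) [IsFiniteMeasure ν] (p : S → P),
      Measurable p → (∀ s, p s ∈ Metric.closedBall p₀ ε) →
      ContDiffAt ℝ n (fun v => ∫ s, W (p s, v) ∂ν) v₀ := by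
  rcases hn with rfl | rfl
  · obtain ⟨r, hr, hrU⟩ := Metric.mem_nhds_iff.1 hU
    refine ⟨r / 2, by positivity, fun ν _ p hp hpr => ?_⟩
    rw [← ball_prod_same] at hrU
    have : ContDiffOn ℝ ∞ (fun v => ∫ s, W (p s, v) ∂ν) (Metric.ball v₀ r) :=
      contDiffOn_infty.2 fun n => contDiffOn_integral_of_measurable_param n hp (half_lt_self hr)
        hpr ((hW.mono hrU).of_le (by exact_mod_cast le_top))
    exact this.contDiffAt (Metric.ball_mem_nhds _ hr)
  · obtain ⟨q, r, hq⟩ := (hW.contDiffAt hU).analyticAt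
    obtain ⟨ε, hε, hεr⟩ : ∃ ε : ℝ, 0 < ε ∧ ENNReal.ofReal ε < r := by
      obtain ⟨ε, h1, h2⟩ := ENNReal.lt_iff_exists_nnreal_btwn.1 hq.r_pos
      exact ⟨ε, by exact_mod_cast h1, by simpa using h2⟩
    refine ⟨ε, hε, fun {S} _ ν _ p hp hpε => ?_⟩
    have := FiniteDimensional.proper_real P
    have := isCompact_iff_compactSpace.1 (isCompact_closedBall p₀ ε)
    obtain ⟨Φ, hΦ, hΦW⟩ := hq.exists_superposition (S := Metric.closedBall p₀ ε)
    -- the affine map `v ↦ (q ↦ (q, v))` into the continuous functions on the ball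
    let A : E → C(Metric.closedBall p₀ ε, P × E) := fun v =>
      ⟨fun q => ((q : P), v), by fun_prop⟩
    have hA0 : Continuous A := by
      refine ContinuousMap.continuous_of_continuous_uncurry _ ?_
      exact (continuous_subtype_val.comp continuous_snd).prodMk continuous_fst
    have hA : ContDiff ℝ ω A := by
      let C : E →L[ℝ] C(Metric.closedBall p₀ ε, P × E) :=
        { toFun := fun v => .const _ (0, v)
          map_add' := fun v w => by ext <;> simp
          map_smul' := fun c v => by ext <;> simp
          cont := ContinuousMap.continuous_of_continuous_uncurry _ (by fun_prop) }
      have : A = fun v => A 0 + C v := by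
        funext v
        ext q <;> simp [A, C]
      rw [this]
      fun_prop
    have hmem : A v₀ ∈ Metric.eball (ContinuousMap.const _ (p₀, v₀)) r := by
      rw [Metric.mem_eball]
      refine lt_of_le_of_lt ?_ hεr
      rw [edist_dist]
      refine ENNReal.ofReal_le_ofReal ((ContinuousMap.dist_le hε.le).2 fun q => ?_)
      simp only [A, ContinuousMap.coe_mk, ContinuousMap.const_apply, Prod.dist_eq, dist_self]
      exact max_le q.2 hε.le
    let pS : S → Metric.closedBall p₀ ε := fun s => ⟨p s, hpε s⟩
    have hpS : Measurable pS := hp.subtype_mk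
    have hint : ∀ g : C(Metric.closedBall p₀ ε, G), Integrable (fun s => g (pS s)) ν := fun g =>
      Integrable.of_bound
        ((g.continuous.aestronglyMeasurable (μ := ν.map pS)).comp_measurable hpS) ‖g‖
        (ae_of_all _ fun s => g.norm_coe_le_norm _)
    -- integration of a continuous function on the ball along `p`
    let I : C(Metric.closedBall p₀ ε, G) →L[ℝ] G := LinearMap.mkContinuous
      { toFun := fun g => ∫ s, g (pS s) ∂ν
        map_add' := fun g h => integral_add (hint g) (hint h)
        map_smul' := fun c g => integral_smul c _ } (ν.real Set.univ) (fun g => by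
        refine (norm_integral_le_of_norm_le_const (ae_of_all _ fun s =>
          g.norm_coe_le_norm (pS s))).trans_eq (mul_comm _ _))
    have h1 : ContDiffAt ℝ ω (fun v => I (Φ (A v))) v₀ :=
      I.contDiff.contDiffAt.comp v₀ ((hΦ _ hmem).contDiffAt.comp v₀ hA.contDiffAt)
    refine h1.congr_of_eventuallyEq ?_
    filter_upwards [hA0.continuousAt.preimage_mem_nhds (Metric.isOpen_eball.mem_nhds hmem)]
      with v hv
    exact integral_congr_ae (ae_of_all _ fun s => (hΦW _ hv (pS s)).symm)

end ParametricIntegral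

/-! ### Analytic total differential equations -/

section TotalDifferentialEquation

variable {Z : Type*} [NormedAddCommGroup Z] [NormedSpace ℝ Z]

/-- The Volterra operator `w ↦ (t ↦ ∫ τ in 0..t, w τ)` on the continuous functions on `[0, 1]`. -/
noncomputable def volterra (Z : Type*) [NormedAddCommGroup Z] [NormedSpace ℝ Z] :
    C(unitInterval, Z) →L[ℝ] C(unitInterval, Z) :=
  LinearMap.mkContinuous
    { toFun := fun w => ⟨fun t => ∫ τ in (0 : ℝ)..t, Set.IccExtend zero_le_one w τ, by
        have := intervalIntegral.continuous_primitive (μ := volume)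
          (f := Set.IccExtend zero_le_one w) (fun a b =>
          (w.continuous.Icc_extend' (h := zero_le_one)).intervalIntegrable a b) 0
        exact this.comp continuous_subtype_val⟩
      map_add' := fun w₁ w₂ => by
        ext t
        simp only [ContinuousMap.coe_mk, ContinuousMap.add_apply]
        rw [← intervalIntegral.integral_add
          ((w₁.continuous.Icc_extend' (h := zero_le_one)).intervalIntegrable _ _)
          ((w₂.continuous.Icc_extend' (h := zero_le_one)).intervalIntegrable _ _)]
        rfl
      map_smul' := fun c w => by
        ext t
        simp only [ContinuousMap.coe_mk, ContinuousMap.smul_apply, RingHom.id_apply]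
        rw [← intervalIntegral.integral_smul]
        rfl }
    1 (fun w => by
      rw [one_mul]
      refine (ContinuousMap.norm_le _ (norm_nonneg _)).2 fun t => ?_
      refine (intervalIntegral.norm_integral_le_of_norm_le_const (C := ‖w‖)
        fun τ _ => w.norm_coe_le_norm _).trans ?_
      rw [sub_zero, abs_of_nonneg t.2.1]
      exact mul_le_of_le_one_right (norm_nonneg _) t.2.2)

theorem volterra_apply (w : C(unitInterval, Z)) (t : unitInterval) :
    volterra Z w t = ∫ τ in (0 : ℝ)..t, Set.IccExtend zero_le_one w τ := rfl

variable {E : Type*} [NormedAddCommGroup E] [NormedSpace ℝ E] [CompleteSpace E] [CompleteSpace Z]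

/-- Solutions `z` of an analytic total differential equation `Dz = F (v, z)` are analytic
functions of the position and of the initial value `z v₀`. Only uniqueness is involved: no
integrability condition on `F` is assumed, and solutions are not claimed to exist. On the segment
from `v₀` to `v₀ + v`, the function `u t = z (v₀ + t v)` satisfies the Volterra equation
`u = z v₀ + ∫ F (v₀ + t v, u t) v`, which is analytic in `(z v₀, v, u)` as an equation for
continuous functions on `[0, 1]`; the analytic implicit function theorem in this Banach space
determines `u` as an analytic function of `(z v₀, v)`. -/
theorem AnalyticAt.exists_solution_map {F : E × Z → E →L[ℝ] Z} {v₀ : E} {z₀ : Z}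
    (hF : AnalyticAt ℝ F (v₀, z₀)) :
    ∃ Y : Z × E → Z, AnalyticAt ℝ Y (z₀, v₀) ∧ ∃ ε > 0, ∀ (z : E → Z), ∀ δ ≤ ε,
      (∀ w ∈ Metric.ball v₀ δ, HasFDerivAt z (F (w, z w)) w) →
      (∀ w ∈ Metric.ball v₀ δ, z w ∈ Metric.ball z₀ ε) →
      ∀ v ∈ Metric.ball v₀ δ, z v = Y (z v₀, v) := by
  have hW : AnalyticAt ℝ (fun q : (E × Z) × E => F q.1 q.2) ((v₀, z₀), (0 : E)) :=
    ((ContDiffAt.comp (g := F) ((v₀, z₀), (0 : E)) hF.contDiffAt contDiffAt_fst).clm_apply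
      contDiffAt_snd : ContDiffAt ℝ ω _ _).analyticAt
  obtain ⟨q, r, hq⟩ := hW
  obtain ⟨Φ, hΦ, hΦW⟩ := hq.exists_superposition (S := unitInterval)
  -- the affine map `(v, u) ↦ (t ↦ ((v₀ + t v, u t), v))`
  let A : E × C(unitInterval, Z) → C(unitInterval, (E × Z) × E) := fun c =>
    ⟨fun t => ((v₀ + (t : ℝ) • c.1, c.2 t), c.1), by fun_prop⟩
  have hA0 : Continuous A := by
    refine ContinuousMap.continuous_of_continuous_uncurry _ ?_
    change Continuous fun x : (E × C(unitInterval, Z)) × unitInterval =>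
      ((v₀ + (x.2 : ℝ) • x.1.1, x.1.2 x.2), x.1.1)
    fun_prop
  have hA : ContDiff ℝ ω A := by
    let C : E × C(unitInterval, Z) →L[ℝ] C(unitInterval, (E × Z) × E) :=
      { toFun := fun c => ⟨fun t => (((t : ℝ) • c.1, c.2 t), c.1), by fun_prop⟩
        map_add' := fun v w => by ext <;> simp
        map_smul' := fun c v => by ext t; exacts [smul_comm _ _ _, rfl, rfl]
        cont := ContinuousMap.continuous_of_continuous_uncurry _ (by
          change Continuous fun x : (E × C(unitInterval, Z)) × unitInterval =>
            (((x.2 : ℝ) • x.1.1, x.1.2 x.2), x.1.1)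
          fun_prop) }
    have : A = fun v => A 0 + C v := by
      funext v
      ext q <;> simp [A, C]
    rw [this]
    fun_prop
  have hA00 : A (0, .const _ z₀) = .const _ ((v₀, z₀), 0) := by
    ext t <;> simp [A]
  have hmem : A (0, .const _ z₀) ∈ Metric.eball (.const unitInterval ((v₀, z₀), (0 : E))) r := by
    rw [hA00]
    exact Metric.mem_eball_self hq.r_pos
  -- the Volterra equation is `f = 0`
  let f : (Z × E) × C(unitInterval, Z) → C(unitInterval, Z) := fun c =>
    c.2 - .const _ c.1.1 - volterra Z (Φ (A (c.1.2, c.2)))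
  let base : (Z × E) × C(unitInterval, Z) := ((z₀, 0), .const _ z₀)
  have hconst : ContDiff ℝ ω fun ζ : Z => ContinuousMap.const unitInterval ζ := by
    let C : Z →L[ℝ] C(unitInterval, Z) :=
      { toFun := fun c => .const _ c
        map_add' := fun v w => by ext; simp
        map_smul' := fun c v => by ext; simp
        cont := ContinuousMap.continuous_of_continuous_uncurry _ (by
          change Continuous fun x : Z × unitInterval => x.1
          fun_prop) }
    exact C.contDiff
  have hf : ContDiffAt ℝ ω f base := by
    have h1 : ContDiffAt ℝ ω (fun c : (Z × E) × C(unitInterval, Z) => Φ (A (c.1.2, c.2))) base :=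
      ContDiffAt.comp (g := Φ) base (hΦ _ hmem).contDiffAt
        (hA.contDiffAt.comp base (by fun_prop))
    exact (contDiffAt_snd.sub (hconst.contDiffAt.comp base (by fun_prop))).sub
      ((volterra Z).contDiff.contDiffAt.comp base h1)
  -- `W` vanishes where the direction `v` does, so `f` is `u ↦ u - z₀` on the slice `v = 0`
  have hslice : ∀ᶠ u in 𝓝 (ContinuousMap.const unitInterval z₀),
      f ((z₀, 0), u) = u - .const _ z₀ := by
    have h1 : Continuous fun u => A (0, u) := hA0.comp (by fun_prop)
    filter_upwards [h1.continuousAt.preimage_mem_nhds (Metric.isOpen_eball.mem_nhds hmem)]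
      with u hu
    have h2 : Φ (A (0, u)) = 0 := by
      ext t
      rw [hΦW _ hu t]
      simp [A]
    simp [f, h2]
  have hfbase : f base = 0 := by
    simpa [base] using hslice.self_of_nhds
  have hinr : fderiv ℝ f base ∘L .inr ℝ (Z × E) C(unitInterval, Z) = .id ℝ _ := by
    have h1 : HasFDerivAt (fun u => f ((z₀, 0), u))
        (fderiv ℝ f base ∘L .inr ℝ (Z × E) C(unitInterval, Z)) (.const unitInterval z₀) :=
      (hf.differentiableAt (by simp)).hasFDerivAt.comp (f := fun u => ((z₀, (0 : E)), u))
        (ContinuousMap.const unitInterval z₀) (hasFDerivAt_prodMk_right _ _)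
    have h2 : HasFDerivAt (fun u => f ((z₀, 0), u)) (.id ℝ _)
        (ContinuousMap.const unitInterval z₀) :=
      ((hasFDerivAt_id _).sub_const _).congr_of_eventuallyEq hslice
    exact h1.unique h2
  have hinv : (fderiv ℝ f base ∘L .inr ℝ (Z × E) C(unitInterval, Z)).IsInvertible := by
    rw [hinr]
    exact ⟨.refl ℝ _, rfl⟩
  have hiff := hf.eventually_apply_eq_iff_implicitFunction (by simp) hinv
  have himp : ContDiffAt ℝ ω (hf.implicitFunction (by simp) hinv) base.1 :=
    hf.contDiffAt_implicitFunction (by simp) hinv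
  set U := hf.implicitFunction (by simp) hinv
  have hA1 : ∀ᶠ c in 𝓝 base, A (c.1.2, c.2) ∈ Metric.eball
      (.const unitInterval ((v₀, z₀), (0 : E))) r := by
    have h1 : Continuous fun c : (Z × E) × C(unitInterval, Z) => A (c.1.2, c.2) :=
      hA0.comp (by fun_prop)
    exact h1.continuousAt.preimage_mem_nhds (Metric.isOpen_eball.mem_nhds hmem)
  obtain ⟨ε, hε, hεU⟩ := Metric.eventually_nhds_iff_ball.1 (hiff.and hA1)
  refine ⟨fun c => U (c.1, c.2 - v₀) 1, ?_, ε, hε, fun z δ hδ hz hzε v hv => ?_⟩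
  · refine ContDiffAt.analyticAt ?_
    let ev : C(unitInterval, Z) →L[ℝ] Z := ContinuousMap.evalCLM ℝ (1 : unitInterval)
    refine ContDiffAt.comp (g := ev) _ ev.contDiff.contDiffAt ?_
    refine ContDiffAt.comp (g := U) (z₀, v₀) ?_ (by fun_prop)
    simpa [base] using himp
  · have hseg : ∀ t : unitInterval, v₀ + (t : ℝ) • (v - v₀) ∈ Metric.ball v₀ δ := fun t => by
      rw [mem_ball_iff_norm, add_sub_cancel_left, norm_smul, Real.norm_of_nonneg t.2.1]
      exact (mul_le_of_le_one_left (norm_nonneg _) t.2.2).trans_lt (mem_ball_iff_norm.1 hv)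
    let u : C(unitInterval, Z) := ⟨fun t => z (v₀ + (t : ℝ) • (v - v₀)), by
      refine continuous_iff_continuousAt.2 fun t => ?_
      exact ContinuousAt.comp (g := z) (hz _ (hseg t)).continuousAt (by fun_prop)⟩
    have hc : ((z v₀, v - v₀), u) ∈ Metric.ball base ε := by
      simp only [base, Metric.mem_ball, Prod.dist_eq, max_lt_iff]
      refine ⟨⟨Metric.mem_ball.1 (hzε _ (by simpa using hseg 0)), ?_⟩, ?_⟩
      · simpa [dist_eq_norm] using (mem_ball_iff_norm.1 hv).trans_le hδ
      · exact (ContinuousMap.dist_lt_iff hε).2 fun t => Metric.mem_ball.1 (hzε _ (hseg t))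
    obtain ⟨h1, h2⟩ := hεU _ hc
    have h3 : f ((z v₀, v - v₀), u) = f base := by
      rw [hfbase]
      ext t
      simp only [f, ContinuousMap.sub_apply, ContinuousMap.const_apply, volterra_apply,
        ContinuousMap.zero_apply]
      have h4 : ∀ τ ∈ Set.uIcc (0 : ℝ) t, HasDerivAt (fun τ : ℝ => z (v₀ + τ • (v - v₀)))
          (Set.IccExtend zero_le_one (Φ (A (v - v₀, u))) τ) τ := by
        intro τ hτ
        rw [Set.uIcc_of_le t.2.1] at hτ
        have hτ' : τ ∈ Set.Icc (0 : ℝ) 1 := ⟨hτ.1, hτ.2.trans t.2.2⟩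
        rw [Set.IccExtend_of_mem _ _ hτ', hΦW _ h2]
        have h5 := hz _ (hseg ⟨τ, hτ'⟩)
        have h6 : HasDerivAt (fun τ : ℝ => v₀ + τ • (v - v₀)) (v - v₀) τ := by
          simpa using ((hasDerivAt_id τ).smul_const (v - v₀)).const_add v₀
        exact h5.comp_hasDerivAt τ h6
      rw [intervalIntegral.integral_eq_sub_of_hasDerivAt h4
        (((Φ (A (v - v₀, u))).continuous.Icc_extend' (h := zero_le_one)).intervalIntegrable _ _)]
      simp [u]
    have h7 := h1.1 h3
    change z v = U (z v₀, v - v₀) 1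
    rw [h7]
    simp [u]

end TotalDifferentialEquation

/-! ### The differential equation of isometries -/

section IsometryEquation

-- for the instances on iterated spaces of continuous linear maps
set_option maxSynthPendingDepth 3
set_option synthInstance.maxHeartbeats 100000

variable {E : Type} [NormedAddCommGroup E] [NormedSpace ℝ E]

/-- The tensor `κ (a, b, c) = ½ (C (a, b, c) + C (b, a, c) - C (c, a, b))`, where
`C = DG - A^* DG'`. If `φ` is an isometry from the metric `G` to the metric `G'`,
`y = φ v` and `A = Dφ v`, then Koszul's computation gives `κ (a, b, c) = G'_y (D²φ (a, b), A c)`. -/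
noncomputable def koszulTensor (G G' : E → E →L[ℝ] E →L[ℝ] ℝ) (q : E × E × (E →L[ℝ] E)) :
    E →L[ℝ] E →L[ℝ] E →L[ℝ] ℝ :=
  let P : (E →L[ℝ] ℝ) →L[ℝ] (E →L[ℝ] ℝ) := (ContinuousLinearMap.compL ℝ E E ℝ).flip q.2.2
  let Q : (E →L[ℝ] E →L[ℝ] ℝ) →L[ℝ] (E →L[ℝ] E →L[ℝ] ℝ) :=
    (ContinuousLinearMap.compL ℝ E (E →L[ℝ] ℝ) (E →L[ℝ] ℝ) P) ∘L
      ((ContinuousLinearMap.compL ℝ E E (E →L[ℝ] ℝ)).flip q.2.2)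
  let C : E →L[ℝ] E →L[ℝ] E →L[ℝ] ℝ := fderiv ℝ G q.1 - Q ∘L fderiv ℝ G' q.2.1 ∘L q.2.2
  (1 / 2 : ℝ) • (C + C.flip -
    (ContinuousLinearMap.flipₗᵢ ℝ E E ℝ).toContinuousLinearEquiv.toContinuousLinearMap ∘L C.flip)

theorem koszulTensor_apply (G G' : E → E →L[ℝ] E →L[ℝ] ℝ) (v y : E) (A : E →L[ℝ] E) (a b c : E) :
    koszulTensor G G' (v, y, A) a b c = 1 / 2 *
      ((fderiv ℝ G v a b c - fderiv ℝ G' y (A a) (A b) (A c))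
      + (fderiv ℝ G v b a c - fderiv ℝ G' y (A b) (A a) (A c))
      - (fderiv ℝ G v c a b - fderiv ℝ G' y (A c) (A a) (A b))) := by
  simp [koszulTensor]

/-- The functional `z ↦ (c ↦ G'_y (z, A c))` whose inverse solves for `D²φ` in the equation of
isometries. -/
noncomputable def lowerIndex (G' : E → E →L[ℝ] E →L[ℝ] ℝ) (q : E × (E →L[ℝ] E)) :
    E →L[ℝ] E →L[ℝ] ℝ :=
  ((ContinuousLinearMap.compL ℝ E E ℝ).flip q.2) ∘L G' q.1

@[simp]
theorem lowerIndex_apply (G' : E → E →L[ℝ] E →L[ℝ] ℝ) (y : E) (A : E →L[ℝ] E) (z c : E) :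
    lowerIndex G' (y, A) z c = G' y z (A c) := rfl

/-- The right-hand side of the total differential equation `D(φ, Dφ) = F (v, (φ, Dφ))` satisfied by
isometries from `G` to `G'`. -/
noncomputable def isometryField (G G' : E → E →L[ℝ] E →L[ℝ] ℝ) (q : E × E × (E →L[ℝ] E)) :
    E →L[ℝ] E × (E →L[ℝ] E) :=
  q.2.2.prod ((ContinuousLinearMap.compL ℝ E (E →L[ℝ] ℝ) E (lowerIndex G' q.2).inverse) ∘L
    koszulTensor G G' q)

theorem isInvertible_lowerIndex [FiniteDimensional ℝ E] {G' : E → E →L[ℝ] E →L[ℝ] ℝ}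
    {y : E} {A : E →L[ℝ] E} (hpos : ∀ a, a ≠ 0 → 0 < G' y a a) (hA : Function.Injective A) :
    (lowerIndex G' (y, A)).IsInvertible := by
  have hinj : Function.Injective (lowerIndex G' (y, A)).toLinearMap := by
    refine (injective_iff_map_eq_zero _).2 fun z hz => ?_
    by_contra hne
    obtain ⟨c, rfl⟩ := (LinearMap.injective_iff_surjective (f := A.toLinearMap)).1 hA z
    have h := DFunLike.congr_fun hz c
    exact (hpos _ hne).ne' h
  have hrank : Module.finrank ℝ E = Module.finrank ℝ (E →L[ℝ] ℝ) := by
    rw [← (LinearMap.toContinuousLinearMap (𝕜 := ℝ) (E := E) (F' := ℝ)).finrank_eq]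
    exact (Subspace.dual_finrank_eq (K := ℝ) (V := E)).symm
  exact ⟨(LinearEquiv.ofInjectiveOfFinrankEq _ hinj hrank).toContinuousLinearEquiv, by ext; rfl⟩

theorem contDiffAt_isometryField [CompleteSpace E] {G G' : E → E →L[ℝ] E →L[ℝ] ℝ}
    {q : E × E × (E →L[ℝ] E)}
    (hG : ContDiffAt ℝ ω G q.1) (hG' : ContDiffAt ℝ ω G' q.2.1)
    (hinv : (lowerIndex G' q.2).IsInvertible) :
    ContDiffAt ℝ ω (isometryField G G') q := by
  have h1 : ContDiffAt ℝ ω (fun q : E × E × (E →L[ℝ] E) => fderiv ℝ G q.1) q :=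
    ContDiffAt.comp (g := fderiv ℝ G) q (hG.fderiv_right (by simp)) contDiffAt_fst
  have h2 : ContDiffAt ℝ ω (fun q : E × E × (E →L[ℝ] E) => fderiv ℝ G' q.2.1) q :=
    ContDiffAt.comp (g := fderiv ℝ G') q (hG'.fderiv_right (by simp)) (by fun_prop)
  have h3 : ContDiffAt ℝ ω (fun q : E × E × (E →L[ℝ] E) => G' q.2.1) q :=
    ContDiffAt.comp (g := G') q hG' (by fun_prop)
  have hA : ContDiffAt ℝ ω (fun q : E × E × (E →L[ℝ] E) => q.2.2) q := by fun_prop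
  have hflip : ∀ {f : E × E × (E →L[ℝ] E) → E →L[ℝ] E →L[ℝ] E →L[ℝ] ℝ}, ContDiffAt ℝ ω f q →
      ContDiffAt ℝ ω (fun q => (f q).flip) q := fun hf =>
    (ContinuousLinearMap.flipₗᵢ ℝ E E (E →L[ℝ] ℝ)).toContinuousLinearEquiv.contDiff.contDiffAt.comp
      q hf
  have hP : ∀ F : Type, [NormedAddCommGroup F] → [NormedSpace ℝ F] →
      ContDiffAt ℝ ω (fun q : E × E × (E →L[ℝ] E) =>
        (ContinuousLinearMap.compL ℝ E E F).flip q.2.2) q := fun F _ _ =>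
    ((ContinuousLinearMap.compL ℝ E E F).flip).contDiff.contDiffAt.comp q hA
  have hκ : ContDiffAt ℝ ω (koszulTensor G G') q := by
    have hC := h1.sub ((((ContinuousLinearMap.compL ℝ E (E →L[ℝ] ℝ)
      (E →L[ℝ] ℝ)).contDiff.contDiffAt.comp q (hP ℝ)).clm_comp (hP (E →L[ℝ] ℝ))).clm_comp
        (h2.clm_comp hA))
    exact ((hC.add (hflip hC)).sub (contDiffAt_const.clm_comp (hflip hC))).const_smul _
  have hL : ContDiffAt ℝ ω (fun q : E × E × (E →L[ℝ] E) => lowerIndex G' q.2) q :=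
    (hP ℝ).clm_comp h3
  obtain ⟨e, he⟩ := hinv
  have hI : ContDiffAt ℝ ω (fun q : E × E × (E →L[ℝ] E) => (lowerIndex G' q.2).inverse) q :=
    ContDiffAt.comp (g := ContinuousLinearMap.inverse) q (he ▸ contDiffAt_map_inverse e) hL
  have := (ContinuousLinearMap.prodₗᵢ (𝕜 := ℝ) (E := E) (F := E)
    (G := E →L[ℝ] E) ℝ).toContinuousLinearEquiv.contDiff.contDiffAt.comp q (hA.prodMk
      (((ContinuousLinearMap.compL ℝ E (E →L[ℝ] ℝ) E).contDiff.contDiffAt.comp q hI).clm_comp hκ))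
  exact this

/-- Koszul's computation: a map `φ` with `φ^* G' = G` satisfies a closed first-order equation for
the pair `(φ, Dφ)`. -/
theorem hasFDerivAt_of_isometry [FiniteDimensional ℝ E] {G G' : E → E →L[ℝ] E →L[ℝ] ℝ}
    {φ : E → E} {v : E}
    (hφ : ContDiffAt ℝ 2 φ v) (hG : DifferentiableAt ℝ G v) (hG' : DifferentiableAt ℝ G' (φ v))
    (hsymm : ∀ a b, G' (φ v) a b = G' (φ v) b a)
    (hpos : ∀ a, a ≠ 0 → 0 < G v a a) (hpos' : ∀ a, a ≠ 0 → 0 < G' (φ v) a a)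
    (hiso : ∀ᶠ w in 𝓝 v, ∀ a b, G' (φ w) (fderiv ℝ φ w a) (fderiv ℝ φ w b) = G w a b) :
    HasFDerivAt (fun w => (φ w, fderiv ℝ φ w))
      (isometryField G G' (v, φ v, fderiv ℝ φ v)) v := by
  set A := fderiv ℝ φ v with hAdef
  have hdφ : HasFDerivAt φ A v := (hφ.differentiableAt (by simp)).hasFDerivAt
  have hd2 : DifferentiableAt ℝ (fderiv ℝ φ) v :=
    (hφ.fderiv_right (m := 1) (by norm_num [one_add_one_eq_two])).differentiableAt (by simp)
  set D := fderiv ℝ (fderiv ℝ φ) v with hDdef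
  have hD : HasFDerivAt (fderiv ℝ φ) D v := hd2.hasFDerivAt
  have hDsymm : ∀ a b, D a b = D b a := fun a b =>
    (hφ.isSymmSndFDerivAt (by simp)).eq a b
  have hiso0 := hiso.self_of_nhds
  have hA : Function.Injective A := by
    refine (injective_iff_map_eq_zero A.toLinearMap).2 fun a ha => ?_
    by_contra hne
    have h := hiso0 a a
    change A a = 0 at ha
    rw [← hAdef, ha] at h
    simp only [map_zero] at h
    exact (hpos a hne).ne h
  have hinv := isInvertible_lowerIndex hpos' hA
  have hder : ∀ a b c, fderiv ℝ G v a b c = fderiv ℝ G' (φ v) (A a) (A b) (A c)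
      + G' (φ v) (D a b) (A c) + G' (φ v) (A b) (D a c) := by
    intro a b c
    have hl : HasFDerivAt (fun w => G w b c) _ v :=
      (hG.hasFDerivAt.clm_apply (hasFDerivAt_const b v)).clm_apply (hasFDerivAt_const c v)
    have hr : HasFDerivAt (fun w => G' (φ w) (fderiv ℝ φ w b) (fderiv ℝ φ w c)) _ v :=
      ((hG'.hasFDerivAt.comp v hdφ).clm_apply (hD.clm_apply (hasFDerivAt_const b v))).clm_apply
        (hD.clm_apply (hasFDerivAt_const c v))
    have heq := (hl.congr_of_eventuallyEq (hiso.mono fun w hw => hw b c)).unique hr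
    have := DFunLike.congr_fun heq a
    simp at this
    rw [this]
    ring
  have hκ : ∀ a, koszulTensor G G' (v, φ v, A) a = lowerIndex G' (φ v, A) ∘L D a := by
    intro a
    ext b c
    rw [koszulTensor_apply, hder a b c, hder b a c, hder c a b]
    simp only [ContinuousLinearMap.comp_apply, lowerIndex_apply]
    rw [hDsymm b a, hDsymm c a, hDsymm c b, hsymm (A a) (D b c), hsymm (A b) (D a c)]
    ring
  have hfield : isometryField G G' (v, φ v, A) = A.prod D := by
    refine congrArg (A.prod ·) (ContinuousLinearMap.ext fun a => ?_)
    change (lowerIndex G' (φ v, A)).inverse ∘L koszulTensor G G' (v, φ v, A) a = D a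
    rw [hκ, ← ContinuousLinearMap.comp_assoc, hinv.inverse_comp_self,
      ContinuousLinearMap.id_comp]
  rw [hfield]
  exact hdφ.prodMk hD

/-- A smooth family of isometries between analytic metrics, near a point `v₀`, is an analytic
function of the position and of the `1`-jet of the isometry at `v₀`. -/
theorem exists_analyticAt_of_isometry_family [FiniteDimensional ℝ E]
    {Θ : Type*} [NormedAddCommGroup Θ] [NormedSpace ℝ Θ]
    {G G' : E → E →L[ℝ] E →L[ℝ] ℝ} {f : Θ × E → E} {θ₀ : Θ} {v₀ : E}
    (hf : ContDiffAt ℝ 2 f (θ₀, v₀)) (hG : AnalyticAt ℝ G v₀) (hG' : AnalyticAt ℝ G' (f (θ₀, v₀)))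
    (hsymm : ∀ᶠ y in 𝓝 (f (θ₀, v₀)), ∀ a b, G' y a b = G' y b a)
    (hpos : ∀ᶠ v in 𝓝 v₀, ∀ a, a ≠ 0 → 0 < G v a a)
    (hpos' : ∀ᶠ y in 𝓝 (f (θ₀, v₀)), ∀ a, a ≠ 0 → 0 < G' y a a)
    (hiso : ∀ᶠ q in 𝓝 (θ₀, v₀), ∀ a b,
      G' (f q) (fderiv ℝ (fun w => f (q.1, w)) q.2 a) (fderiv ℝ (fun w => f (q.1, w)) q.2 b)
        = G q.2 a b) :
    ∃ Y : (E × (E →L[ℝ] E)) × E → E,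
      AnalyticAt ℝ Y ((f (θ₀, v₀), fderiv ℝ (fun w => f (θ₀, w)) v₀), v₀) ∧
      ∀ᶠ q in 𝓝 (θ₀, v₀), f q = Y ((f (q.1, v₀), fderiv ℝ (fun w => f (q.1, w)) v₀), q.2) := by
  have := FiniteDimensional.complete ℝ E
  set y₀ := f (θ₀, v₀)
  set A₀ := fderiv ℝ (fun w => f (θ₀, w)) v₀ with hA₀
  have hA₀inj : Function.Injective A₀ := by
    refine (injective_iff_map_eq_zero A₀.toLinearMap).2 fun a ha => ?_
    by_contra hne
    have h := hiso.self_of_nhds a a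
    change A₀ a = 0 at ha
    simp only [← hA₀] at h
    rw [ha] at h
    simp only [map_zero] at h
    exact (hpos.self_of_nhds a hne).ne h
  have hF : AnalyticAt ℝ (isometryField G G') (v₀, (y₀, A₀)) :=
    (contDiffAt_isometryField (q := (v₀, (y₀, A₀))) hG.contDiffAt hG'.contDiffAt
      (isInvertible_lowerIndex hpos'.self_of_nhds hA₀inj)).analyticAt
  obtain ⟨Y, hY, ε, hε, hYε⟩ := hF.exists_solution_map
  refine ⟨fun q => (Y q).1, analyticAt_fst.comp hY, ?_⟩
  have hpartial : ∀ᶠ q in 𝓝 (θ₀, v₀), fderiv ℝ (fun w => f (q.1, w)) q.2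
      = fderiv ℝ f q ∘L .inr ℝ Θ E := by
    filter_upwards [(hf.eventually (by simp))] with q hq
    exact ((hq.differentiableAt (by simp)).hasFDerivAt.comp (f := fun w => (q.1, w)) q.2
      (hasFDerivAt_prodMk_right _ _)).fderiv
  have hcont : ContinuousAt (fun q : Θ × E => (f q, fderiv ℝ (fun w => f (q.1, w)) q.2))
      (θ₀, v₀) := by
    refine hf.continuousAt.prodMk ?_
    refine ContinuousAt.congr ?_ (hpartial.mono fun q hq => hq.symm)
    exact ((hf.fderiv_right (m := 1) (by norm_num [one_add_one_eq_two])).continuousAt).clm_comp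
      continuousAt_const
  have hall : ∀ᶠ q in 𝓝 (θ₀, v₀),
      (ContDiffAt ℝ 2 f q ∧ DifferentiableAt ℝ G q.2 ∧ DifferentiableAt ℝ G' (f q)) ∧
      ((∀ a b, G' (f q) a b = G' (f q) b a) ∧ (∀ a, a ≠ 0 → 0 < G q.2 a a) ∧
      (∀ a, a ≠ 0 → 0 < G' (f q) a a)) ∧
      (∀ᶠ q in 𝓝 q, ∀ a b, G' (f q) (fderiv ℝ (fun w => f (q.1, w)) q.2 a)
        (fderiv ℝ (fun w => f (q.1, w)) q.2 b) = G q.2 a b) ∧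
      (f q, fderiv ℝ (fun w => f (q.1, w)) q.2) ∈ Metric.ball (y₀, A₀) ε := by
    have hs : Tendsto (fun q : Θ × E => q.2) (𝓝 (θ₀, v₀)) (𝓝 v₀) := continuousAt_snd
    refine ((hf.eventually (by simp)).and ?_).and (.and ?_ (hiso.eventually_nhds.and ?_))
    · exact (hs.eventually (hG.eventually_analyticAt.mono fun v hv => hv.differentiableAt)).and
        (hf.continuousAt.eventually
          (hG'.eventually_analyticAt.mono fun v hv => hv.differentiableAt))
    · exact (hf.continuousAt.eventually hsymm).and
        ((hs.eventually hpos).and (hf.continuousAt.eventually hpos'))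
    · exact hcont.preimage_mem_nhds (Metric.ball_mem_nhds _ hε)
  obtain ⟨δ, hδ, hδall⟩ := Metric.eventually_nhds_iff_ball.1 hall
  rw [← ball_prod_same] at hδall
  filter_upwards [ball_prod_same θ₀ v₀ (min δ ε) ▸
    Metric.ball_mem_nhds (θ₀, v₀) (lt_min hδ hε)] with q hq
  have hθ : ∀ w ∈ Metric.ball v₀ (min δ ε), (q.1, w) ∈ Metric.ball θ₀ δ ×ˢ Metric.ball v₀ δ :=
    fun w hw => ⟨Metric.ball_subset_ball (min_le_left _ _) hq.1,
      Metric.ball_subset_ball (min_le_left _ _) hw⟩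
  refine congrArg Prod.fst (hYε (fun w => (f (q.1, w), fderiv ℝ (fun w => f (q.1, w)) w))
    (min δ ε) (min_le_right _ _) (fun w hw => ?_) (fun w hw => ?_) q.2 hq.2)
  · obtain ⟨⟨h1, h2, h3⟩, ⟨h4, h5, h6⟩, h7, -⟩ := hδall _ (hθ w hw)
    have hslice : ContinuousAt (fun w => (q.1, w)) w := by fun_prop
    exact hasFDerivAt_of_isometry (φ := fun w => f (q.1, w))
      (h1.comp w (by fun_prop)) h2 h3 h4 h5 h6 (hslice.eventually h7)
  · exact (hδall _ (hθ w hw)).2.2.2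

end IsometryEquation

/-! ### Fourier coefficients on the torus -/

section TorusFourier

-- the normalized Haar measure, in terms of which `UnitAddTorus.mFourierCoeff` is defined
noncomputable local instance : MeasureSpace UnitAddCircle := ⟨AddCircle.haarAddCircle⟩

local instance : Measure.IsAddHaarMeasure (volume : Measure UnitAddCircle) :=
  inferInstanceAs (Measure.IsAddHaarMeasure AddCircle.haarAddCircle)

local instance : IsProbabilityMeasure (volume : Measure UnitAddCircle) :=
  inferInstanceAs (IsProbabilityMeasure AddCircle.haarAddCircle)

variable {N : ℕ}

/-- The projection `ℝᴺ → ℝᴺ / ℤᴺ`. -/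
def torusMk (x : Fin N → ℝ) : UnitAddTorus (Fin N) := fun i => (x i : UnitAddCircle)

theorem torusMk_add (x y : Fin N → ℝ) : torusMk (x + y) = torusMk x + torusMk y := rfl

theorem isOpenQuotientMap_torusMk : IsOpenQuotientMap (torusMk (N := N)) :=
  IsOpenQuotientMap.piMap (f := fun (_ : Fin N) (x : ℝ) => (x : UnitAddCircle))
    fun _ => QuotientAddGroup.isOpenQuotientMap_mk

theorem continuous_torusMk : Continuous (torusMk (N := N)) := isOpenQuotientMap_torusMk.continuous

theorem torusMk_surjective : Function.Surjective (torusMk (N := N)) :=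
  isOpenQuotientMap_torusMk.surjective

theorem mFourier_add_apply (m : Fin N → ℤ) (s t : UnitAddTorus (Fin N)) :
    UnitAddTorus.mFourier m (s + t) = UnitAddTorus.mFourier m s * UnitAddTorus.mFourier m t := by
  simp only [UnitAddTorus.mFourier, ContinuousMap.coe_mk, Pi.add_apply, ← Finset.prod_mul_distrib]
  refine Finset.prod_congr rfl fun i _ => ?_
  rw [fourier_apply, fourier_apply, fourier_apply, smul_add, AddCircle.toCircle_add, Circle.coe_mul]

theorem mFourier_torusMk (m : Fin N → ℤ) (x : Fin N → ℝ) :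
    UnitAddTorus.mFourier m (torusMk x)
      = Complex.exp (2 * π * Complex.I * ((∑ i, m i * x i : ℝ) : ℂ)) := by
  simp only [UnitAddTorus.mFourier, ContinuousMap.coe_mk, torusMk, fourier_coe_apply]
  rw [← Complex.exp_sum]
  push_cast
  rw [Finset.mul_sum]
  congr 1
  exact Finset.sum_congr rfl fun i _ => by ring

/-- A smooth `ℤᴺ`-periodic function on `ℝᴺ`, that is, a smooth function on the torus. -/
structure SmoothPeriodic (f : (Fin N → ℝ) → ℂ) : Prop where
  contDiff : ContDiff ℝ ∞ f
  periodic : ∀ (k : Fin N → ℤ) x, f (x + fun i => (k i : ℝ)) = f x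

/-- The function on the torus induced by a function on `ℝᴺ`, meaningful for periodic functions:
its value at `t` is the value at the representative of `t` in `[0, 1)ᴺ`. -/
noncomputable def torusLift (f : (Fin N → ℝ) → ℂ) (t : UnitAddTorus (Fin N)) : ℂ :=
  f fun i => (AddCircle.equivIco 1 0 (t i) : ℝ)

/-- The derivative in the direction `w`. -/
noncomputable def dirDeriv (w : Fin N → ℝ) (f : (Fin N → ℝ) → ℂ) (x : Fin N → ℝ) : ℂ :=
  fderiv ℝ f x w

/-- The operator `∏ (1 - ∂ᵢ²)`, the product over the entries `i` of a list. -/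
noncomputable def smoothingOp (L : List (Fin N)) (f : (Fin N → ℝ) → ℂ) : (Fin N → ℝ) → ℂ :=
  L.foldr (fun i g => g - dirDeriv (Pi.single i 1) (dirDeriv (Pi.single i 1) g)) f

/-- The Fourier multiplier `∏ (1 + (2 π mᵢ)²)` of `smoothingOp L`. -/
noncomputable def smoothingSymbol (L : List (Fin N)) (m : Fin N → ℤ) : ℝ :=
  (L.map fun i => 1 + (2 * π * m i) ^ 2).prod

theorem smoothingSymbol_pos (L : List (Fin N)) (m : Fin N → ℤ) : 0 < smoothingSymbol L m :=
  List.prod_pos (by simp only [List.mem_map]; rintro _ ⟨i, _, rfl⟩; positivity)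

theorem smoothingOp_translate (f : (Fin N → ℝ) → ℂ) (L : List (Fin N)) (u : Fin N → ℝ) :
    smoothingOp L (fun x => f (x + u)) = fun x => smoothingOp L f (x + u) := by
  have hd : ∀ (w : Fin N → ℝ) (g : (Fin N → ℝ) → ℂ),
      dirDeriv w (fun x => g (x + u)) = fun x => dirDeriv w g (x + u) := by
    intro w g
    funext x
    simp only [dirDeriv, fderiv_comp_add_right]
  induction L with
  | nil => rfl
  | cons i L ih =>
    have h : ∀ g : (Fin N → ℝ) → ℂ, smoothingOp (i :: L) g = smoothingOp L g -
      dirDeriv (Pi.single i 1) (dirDeriv (Pi.single i 1) (smoothingOp L g)) :=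
      fun g => rfl
    rw [h, h, ih, hd, hd]
    rfl

namespace SmoothPeriodic

variable {f g : (Fin N → ℝ) → ℂ}

theorem torusLift_mk (hf : SmoothPeriodic f) (x : Fin N → ℝ) : torusLift f (torusMk x) = f x := by
  have h := hf.periodic (fun i => -⌊x i⌋) x
  rw [← h, torusLift]
  congr 1
  ext i
  simp only [torusMk, AddCircle.coe_equivIco_mk_apply, div_one, mul_one, Pi.add_apply, Int.cast_neg]
  rw [Int.fract]
  ring

theorem continuous_torusLift (hf : SmoothPeriodic f) : Continuous (torusLift f) := by
  rw [isOpenQuotientMap_torusMk.isQuotientMap.continuous_iff]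
  have : torusLift f ∘ torusMk = f := funext hf.torusLift_mk
  rw [this]
  exact hf.contDiff.continuous

theorem translate (hf : SmoothPeriodic f) (u : Fin N → ℝ) : SmoothPeriodic fun x => f (x + u) where
  contDiff := hf.contDiff.comp (by fun_prop)
  periodic k x := by rw [add_right_comm, hf.periodic]

theorem sub (hf : SmoothPeriodic f) (hg : SmoothPeriodic g) : SmoothPeriodic (f - g) where
  contDiff := hf.contDiff.sub hg.contDiff
  periodic k x := by simp only [Pi.sub_apply, hf.periodic, hg.periodic]

theorem dirDeriv (hf : SmoothPeriodic f) (w : Fin N → ℝ) : SmoothPeriodic (dirDeriv w f) where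
  contDiff := (hf.contDiff.fderiv_right (m := ∞) (by simp)).clm_apply contDiff_const
  periodic k x := by
    have : (fun y => f (y + fun i => (k i : ℝ))) = f := funext (hf.periodic k)
    unfold _root_.dirDeriv
    conv_rhs => rw [← this, fderiv_comp_add_right]

theorem smoothingOp (hf : SmoothPeriodic f) (L : List (Fin N)) :
    SmoothPeriodic (smoothingOp L f) := by
  induction L with
  | nil => exact hf
  | cons i L ih => exact ih.sub ((ih.dirDeriv _).dirDeriv _)

theorem hasDerivAt_line (hf : SmoothPeriodic f) (x w : Fin N → ℝ) (s : ℝ) :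
    HasDerivAt (fun s : ℝ => f (x + s • w)) (_root_.dirDeriv w f (x + s • w)) s := by
  have h1 : HasDerivAt (fun s : ℝ => x + s • w) w s := by
    simpa using ((hasDerivAt_id s).smul_const w).const_add x
  exact ((hf.contDiff.differentiable (by simp)).differentiableAt.hasFDerivAt).comp_hasDerivAt s h1

theorem torusLift_translate (hf : SmoothPeriodic f) (u : Fin N → ℝ) (t : UnitAddTorus (Fin N)) :
    torusLift (fun x => f (x + u)) t = torusLift f (t + torusMk u) := by
  obtain ⟨x, rfl⟩ := torusMk_surjective t
  rw [(hf.translate u).torusLift_mk, ← torusMk_add, hf.torusLift_mk]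

theorem mFourierCoeff_translate (hf : SmoothPeriodic f) (u : Fin N → ℝ) (m : Fin N → ℤ) :
    UnitAddTorus.mFourierCoeff (torusLift fun x => f (x + u)) m
      = UnitAddTorus.mFourier m (torusMk u) * UnitAddTorus.mFourierCoeff (torusLift f) m := by
  rw [UnitAddTorus.mFourierCoeff, UnitAddTorus.mFourierCoeff, ← integral_const_mul,
    ← integral_add_right_eq_self (fun t => UnitAddTorus.mFourier m (torusMk u) *
      UnitAddTorus.mFourier (-m) t • torusLift f t) (torusMk u)]
  refine integral_congr_ae (ae_of_all _ fun t => ?_)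
  have h1 : UnitAddTorus.mFourier m (torusMk u) * UnitAddTorus.mFourier (-m) (torusMk u) = 1 := by
    rw [← UnitAddTorus.mFourier_add, add_neg_cancel, UnitAddTorus.mFourier_zero,
      ContinuousMap.one_apply]
  simp only [smul_eq_mul, hf.torusLift_translate, mFourier_add_apply]
  linear_combination (-(UnitAddTorus.mFourier (-m) t * torusLift f (t + torusMk u))) * h1

theorem exists_norm_torusLift_le (hf : SmoothPeriodic f) : ∃ C, ∀ t, ‖torusLift f t‖ ≤ C := by
  obtain ⟨C, hC⟩ := isCompact_univ.exists_bound_of_continuousOn hf.continuous_torusLift.continuousOn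
  exact ⟨C, fun t => hC t (Set.mem_univ t)⟩

theorem mFourierCoeff_dirDeriv (hf : SmoothPeriodic f) (w : Fin N → ℝ) (m : Fin N → ℤ) :
    UnitAddTorus.mFourierCoeff (torusLift (_root_.dirDeriv w f)) m
      = 2 * π * Complex.I * ((∑ i, m i * w i : ℝ) : ℂ) *
        UnitAddTorus.mFourierCoeff (torusLift f) m := by
  obtain ⟨C, hC⟩ := (hf.dirDeriv w).exists_norm_torusLift_le
  have hcont : ∀ {h : (Fin N → ℝ) → ℂ}, SmoothPeriodic h → ∀ s : ℝ,
      Continuous fun t : UnitAddTorus (Fin N) =>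
        UnitAddTorus.mFourier (-m) t • torusLift h (t + torusMk (s • w)) := fun hh s =>
    (map_continuous (UnitAddTorus.mFourier (-m))).smul
      (hh.continuous_torusLift.comp (continuous_add_const (torusMk (s • w))))
  -- both sides are the derivative at `s = 0` of the coefficient of the translate by `s w`
  have h1 := (hasDerivAt_integral_of_dominated_loc_of_deriv_le (μ := volume) (𝕜 := ℝ)
    (s := Set.univ) (x₀ := (0 : ℝ)) (bound := fun _ => C)
    (F := fun s t => UnitAddTorus.mFourier (-m) t • torusLift f (t + torusMk (s • w)))
    (F' := fun s t => UnitAddTorus.mFourier (-m) t •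
      torusLift (_root_.dirDeriv w f) (t + torusMk (s • w)))
    univ_mem (Eventually.of_forall fun s => (hcont hf s).aestronglyMeasurable)
    ((hcont hf 0).integrable_of_hasCompactSupport (HasCompactSupport.of_compactSpace _))
    (hcont (hf.dirDeriv w) 0).aestronglyMeasurable
    (ae_of_all _ fun t s _ => by
      rw [norm_smul]
      refine (mul_le_of_le_one_left (norm_nonneg _) ?_).trans (hC _)
      exact ((UnitAddTorus.mFourier (-m)).norm_coe_le_norm t).trans UnitAddTorus.mFourier_norm.le)
    (integrable_const C)
    (ae_of_all _ fun t s _ => by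
      obtain ⟨x, rfl⟩ := torusMk_surjective t
      simp only [← torusMk_add, hf.torusLift_mk, (hf.dirDeriv w).torusLift_mk]
      exact (hf.hasDerivAt_line x w s).const_mul (UnitAddTorus.mFourier (-m) (torusMk x)))).2
  have h2 : HasDerivAt (fun s : ℝ => Complex.exp (2 * π * Complex.I *
      ((∑ i, m i * (s • w) i : ℝ) : ℂ)) * UnitAddTorus.mFourierCoeff (torusLift f) m)
      (2 * π * Complex.I * ((∑ i, m i * w i : ℝ) : ℂ) *
        UnitAddTorus.mFourierCoeff (torusLift f) m) 0 := by
    have h3 : ∀ s : ℝ, ((∑ i, m i * (s • w) i : ℝ) : ℂ) = (s : ℂ) * ((∑ i, m i * w i : ℝ) : ℂ) := by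
      intro s
      rw [← Complex.ofReal_mul, Finset.mul_sum]
      congr 1
      exact Finset.sum_congr rfl fun i _ => by simp only [Pi.smul_apply, smul_eq_mul]; ring
    simp only [h3]
    have h4 : HasDerivAt (fun s : ℝ => 2 * π * Complex.I * ((s : ℂ) *
        ((∑ i, m i * w i : ℝ) : ℂ))) (2 * π * Complex.I * ((∑ i, m i * w i : ℝ) : ℂ)) 0 := by
      simpa using ((Complex.ofRealCLM.hasDerivAt (x := (0 : ℝ))).mul_const
        ((∑ i, m i * w i : ℝ) : ℂ)).const_mul (2 * π * Complex.I)
    simpa using h4.cexp.mul_const (UnitAddTorus.mFourierCoeff (torusLift f) m)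
  have h5 : (fun s : ℝ => ∫ t, UnitAddTorus.mFourier (-m) t • torusLift f (t + torusMk (s • w)))
      = fun s : ℝ => Complex.exp (2 * π * Complex.I *
      ((∑ i, m i * (s • w) i : ℝ) : ℂ)) * UnitAddTorus.mFourierCoeff (torusLift f) m := by
    funext s
    rw [← mFourier_torusMk, ← hf.mFourierCoeff_translate, UnitAddTorus.mFourierCoeff]
    simp only [hf.torusLift_translate]
  rw [h5] at h1
  have h6 := h1.unique h2
  rw [← h6, UnitAddTorus.mFourierCoeff]
  have : torusMk (0 : Fin N → ℝ) = 0 := rfl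
  simp [this]

theorem mFourierCoeff_smoothingOp (hf : SmoothPeriodic f) (L : List (Fin N)) (m : Fin N → ℤ) :
    UnitAddTorus.mFourierCoeff (torusLift (_root_.smoothingOp L f)) m
      = smoothingSymbol L m * UnitAddTorus.mFourierCoeff (torusLift f) m := by
  induction L with
  | nil => simp [_root_.smoothingOp, smoothingSymbol]
  | cons i L ih =>
    have hL := hf.smoothingOp L
    have hi := (hL.dirDeriv (Pi.single i 1)).dirDeriv (Pi.single i 1)
    have hint : ∀ {h : (Fin N → ℝ) → ℂ}, SmoothPeriodic h → Integrable
        fun t => UnitAddTorus.mFourier (-m) t • torusLift h t := fun hh =>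
      Continuous.integrable_of_hasCompactSupport
        ((map_continuous (UnitAddTorus.mFourier (-m))).smul hh.continuous_torusLift)
        (HasCompactSupport.of_compactSpace _)
    have h1 : UnitAddTorus.mFourierCoeff (torusLift (_root_.smoothingOp (i :: L) f)) m
        = UnitAddTorus.mFourierCoeff (torusLift (_root_.smoothingOp L f)) m
        - UnitAddTorus.mFourierCoeff (torusLift (_root_.dirDeriv (Pi.single i 1)
          (_root_.dirDeriv (Pi.single i 1) (_root_.smoothingOp L f)))) m := by
      simp only [UnitAddTorus.mFourierCoeff]
      rw [← integral_sub (hint hL) (hint hi)]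
      refine integral_congr_ae (ae_of_all _ fun t => ?_)
      simp only [← smul_sub]
      rfl
    rw [h1, (hL.dirDeriv _).mFourierCoeff_dirDeriv, hL.mFourierCoeff_dirDeriv, ih]
    have h2 : (∑ j, (m j : ℝ) * (Pi.single i 1 : Fin N → ℝ) j) = m i := by
      simp [Pi.single_apply]
    rw [h2, smoothingSymbol, smoothingSymbol, List.map_cons, List.prod_cons]
    push_cast
    linear_combination (-(4 * π ^ 2 * (m i : ℂ) ^ 2) *
      ((L.map fun i => 1 + (2 * π * m i) ^ 2).prod : ℝ) *
      UnitAddTorus.mFourierCoeff (torusLift f) m) * Complex.I_sq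

end SmoothPeriodic

/-! ### Small divisors and the cohomological equation on the torus -/

theorem one_le_smoothingSymbol (L : List (Fin N)) (m : Fin N → ℤ) : 1 ≤ smoothingSymbol L m := by
  induction L with
  | nil => simp [smoothingSymbol]
  | cons i L ih =>
    rw [smoothingSymbol, List.map_cons, List.prod_cons]
    exact one_le_mul_of_one_le_of_one_le (le_add_of_nonneg_right (sq_nonneg _)) ih

theorem smoothingSymbol_finRange (m : Fin N → ℤ) :
    smoothingSymbol (List.finRange N) m = ∏ i, (1 + (2 * π * m i) ^ 2) := by
  rw [smoothingSymbol, ← List.ofFn_eq_map, List.prod_ofFn]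

theorem smoothingSymbol_flatten_replicate (k : ℕ) (L : List (Fin N)) (m : Fin N → ℤ) :
    smoothingSymbol (List.replicate k L).flatten m = smoothingSymbol L m ^ k := by
  induction k with
  | zero => simp [smoothingSymbol]
  | succ k ih =>
    rw [List.replicate_succ, List.flatten_cons, smoothingSymbol, List.map_append,
      List.prod_append, pow_succ', ← ih]
    rfl

theorem summable_inv_smoothingSymbol_finRange :
    Summable fun m : Fin N → ℤ => (smoothingSymbol (List.finRange N) m)⁻¹ := by
  have h1 : Summable fun n : ℤ => (1 + (2 * π * n) ^ 2)⁻¹ := by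
    refine Summable.of_nonneg_of_le (fun n => by positivity) (fun n => ?_)
      ((Real.summable_one_div_int_pow (p := 2)).2 one_lt_two |>.add
        (summable_of_hasFiniteSupport (f := fun n : ℤ => if n = 0 then (1 : ℝ) else 0)
          ((Set.finite_singleton 0).subset (by intro n; simp))))
    by_cases hn : n = 0
    · simp [hn]
    · have hn' : (0 : ℝ) < (n : ℝ) ^ 2 := by positivity
      simp only [hn, if_false, add_zero, one_div]
      refine inv_anti₀ hn' ?_
      have : (1 : ℝ) ≤ (2 * π) ^ 2 := by nlinarith [Real.pi_gt_three]
      nlinarith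
  refine summable_of_sum_le (c := ∏ _i : Fin N, ∑' n : ℤ, (1 + (2 * π * n) ^ 2)⁻¹)
    (fun m => by have := smoothingSymbol_pos (List.finRange N) m; positivity) fun u => ?_
  classical
  have hsub : u ⊆ Fintype.piFinset fun i => u.image fun m => m i := fun m hm =>
    Fintype.mem_piFinset.2 fun i => Finset.mem_image_of_mem _ hm
  calc ∑ m ∈ u, (smoothingSymbol (List.finRange N) m)⁻¹
      ≤ ∑ m ∈ Fintype.piFinset fun i => u.image fun m => m i,
          ∏ i, (1 + (2 * π * m i) ^ 2)⁻¹ := by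
        simp only [smoothingSymbol_finRange, Finset.prod_inv_distrib]
        exact Finset.sum_le_sum_of_subset_of_nonneg hsub fun m _ _ => by positivity
    _ = ∏ i, ∑ n ∈ u.image fun m => m i, (1 + (2 * π * n) ^ 2)⁻¹ :=
        (Finset.prod_univ_sum (fun i => u.image fun m => m i)
          fun _ (n : ℤ) => (1 + (2 * π * n) ^ 2)⁻¹).symm
    _ ≤ _ := Finset.prod_le_prod (fun i _ => by positivity) fun i _ =>
        h1.sum_le_tsum _ fun n _ => by positivity

theorem norm_le_smoothingSymbol_finRange (m : Fin N → ℤ) :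
    ‖(WithLp.toLp 2 (fun i => (m i : ℝ)) : EuclideanSpace ℝ (Fin N))‖
      ≤ smoothingSymbol (List.finRange N) m := by
  have h1 : ∀ s : Finset (Fin N),
      1 + ∑ i ∈ s, (m i : ℝ) ^ 2 ≤ ∏ i ∈ s, (1 + (2 * π * m i) ^ 2) := by
    intro s
    induction s using Finset.cons_induction with
    | empty => simp
    | cons i s hi ih =>
      rw [Finset.sum_cons, Finset.prod_cons]
      have h2 : (m i : ℝ) ^ 2 ≤ (2 * π * m i) ^ 2 := by
        rw [mul_pow]
        exact le_mul_of_one_le_left (sq_nonneg _) (by nlinarith [Real.pi_gt_three])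
      have h3 : 0 ≤ ∑ i ∈ s, (m i : ℝ) ^ 2 := Finset.sum_nonneg fun i _ => sq_nonneg _
      nlinarith [sq_nonneg ((m i : ℝ)), mul_nonneg (sq_nonneg ((2 * π * m i) : ℝ)) h3]
  have h4 := h1 Finset.univ
  rw [← smoothingSymbol_finRange] at h4
  rw [EuclideanSpace.norm_eq]
  refine Real.sqrt_le_iff.2 ⟨(smoothingSymbol_pos _ _).le, ?_⟩
  have h5 := one_le_smoothingSymbol (List.finRange N) m
  simp only [Real.norm_eq_abs, sq_abs]
  nlinarith

/-- The small divisors `Ω · m` with `m ≠ 0` do not vanish, and their inverses grow at most like a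
power of the Fourier multiplier of `∏ (1 - ∂ᵢ²)`. The finitely many exceptions in the diophantine
condition are absorbed in the constant. -/
theorem IsDiophantine.exists_inv_abs_le {Ω : EuclideanSpace ℝ (Fin N)} (hΩ : IsDiophantine Ω) :
    ∃ (C : ℝ) (k : ℕ), ∀ m : Fin N → ℤ, m ≠ 0 → (∑ i, Ω i * (m i : ℝ)) ≠ 0 ∧
      |∑ i, Ω i * (m i : ℝ)|⁻¹ ≤ C * smoothingSymbol (List.finRange N) m ^ k := by
  obtain ⟨q, hq⟩ := hΩ
  -- a resonance `m` would give the infinitely many resonances `n m`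
  have hne : ∀ m : Fin N → ℤ, m ≠ 0 → (∑ i, Ω i * (m i : ℝ)) ≠ 0 := by
    intro m hm h0
    have hinj : Function.Injective fun n : ℕ => (n : ℤ) • m := by
      intro a b hab
      exact_mod_cast smul_left_injective ℤ hm hab
    refine (Set.infinite_range_of_injective hinj) (Set.Finite.subset hq ?_)
    rintro _ ⟨n, rfl⟩
    have : ∑ i, Ω i * (((n : ℤ) • m) i : ℝ) = 0 := by
      have : ∀ i, Ω i * (((n : ℤ) • m) i : ℝ) = n * (Ω i * (m i : ℝ)) := fun i => by
        simp only [Pi.smul_apply, smul_eq_mul]; push_cast; ring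
      simp only [this, ← Finset.mul_sum, h0, mul_zero]
    simp only [Set.mem_compl_iff, Set.mem_ofPred_eq, this, abs_zero, not_lt, gt_iff_lt]
    positivity
  obtain ⟨k, hk⟩ := exists_nat_ge q
  have hfin : {m : Fin N → ℤ | ¬ |∑ i, Ω i * (m i : ℝ)| > ‖Ω‖ *
    ‖(WithLp.toLp 2 (fun i => (m i : ℝ)) : EuclideanSpace ℝ (Fin N))‖ ^ (-q)}.Finite := hq
  refine ⟨‖Ω‖⁻¹ + ∑ m ∈ hfin.toFinset, |∑ i, Ω i * (m i : ℝ)|⁻¹, k, fun m hm => ⟨hne m hm, ?_⟩⟩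
  have hR := one_le_smoothingSymbol (List.finRange N) m
  have hRk : 1 ≤ smoothingSymbol (List.finRange N) m ^ k := one_le_pow₀ hR
  have hs : 0 ≤ ∑ m ∈ hfin.toFinset, |∑ i, Ω i * (m i : ℝ)|⁻¹ :=
    Finset.sum_nonneg fun _ _ => by positivity
  by_cases hmq : |∑ i, Ω i * (m i : ℝ)| > ‖Ω‖ *
      ‖(WithLp.toLp 2 (fun i => (m i : ℝ)) : EuclideanSpace ℝ (Fin N))‖ ^ (-q)
  · have hΩ0 : 0 < ‖Ω‖ := by
      refine norm_pos_iff.2 fun h => hne m hm ?_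
      simp [h]
    set r := ‖(WithLp.toLp 2 (fun i => (m i : ℝ)) : EuclideanSpace ℝ (Fin N))‖ with hr
    have hr1 : 1 ≤ r := by
      obtain ⟨i, hi⟩ := Function.ne_iff.1 hm
      refine le_trans ?_ (PiLp.norm_apply_le
        (WithLp.toLp 2 (fun i => (m i : ℝ)) : EuclideanSpace ℝ (Fin N)) i)
      rw [Real.norm_eq_abs]
      have h := Int.one_le_abs hi
      change (1 : ℝ) ≤ |(m i : ℝ)|
      exact_mod_cast h
    have hr0 : 0 < r := one_pos.trans_le hr1
    calc |∑ i, Ω i * (m i : ℝ)|⁻¹ ≤ (‖Ω‖ * r ^ (-q))⁻¹ := inv_anti₀ (by positivity) hmq.le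
      _ = ‖Ω‖⁻¹ * r ^ q := by rw [mul_inv, Real.rpow_neg hr0.le, inv_inv]
      _ ≤ ‖Ω‖⁻¹ * smoothingSymbol (List.finRange N) m ^ k := by
        gcongr
        calc r ^ q ≤ r ^ (k : ℝ) := Real.rpow_le_rpow_of_exponent_le hr1 hk
          _ = r ^ k := Real.rpow_natCast _ _
          _ ≤ _ := pow_le_pow_left₀ hr0.le (norm_le_smoothingSymbol_finRange m) k
      _ ≤ _ := by gcongr; linarith
  · calc |∑ i, Ω i * (m i : ℝ)|⁻¹ ≤ ∑ m ∈ hfin.toFinset, |∑ i, Ω i * (m i : ℝ)|⁻¹ :=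
        Finset.single_le_sum (f := fun m : Fin N → ℤ => |∑ i, Ω i * (m i : ℝ)|⁻¹)
          (fun _ _ => by positivity) (hfin.mem_toFinset.2 hmq)
      _ ≤ ‖Ω‖⁻¹ + ∑ m ∈ hfin.toFinset, |∑ i, Ω i * (m i : ℝ)|⁻¹ :=
        le_add_of_nonneg_left (by positivity)
      _ ≤ _ := le_mul_of_one_le_right (by positivity) hRk

/-- The cohomological equation on the torus: a fixed continuous kernel `K`, paired with
`smoothingOp L f`, solves it along lines of direction `Ω / 2π`, for every smooth `f`, up to the
mean value of `f`. The coefficients `1 / (i (Ω · m) R m ^ (k + 1))` of `K` at `-m`, where `R` is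
the multiplier of `∏ (1 - ∂ᵢ²)`, are summable because one factor `R m` is left over after the
small divisor is estimated by `R m ^ k`. -/
theorem IsDiophantine.exists_kernel {Ω : EuclideanSpace ℝ (Fin N)} (hΩ : IsDiophantine Ω) :
    ∃ (L : List (Fin N)) (K : C(UnitAddTorus (Fin N), ℂ)), ∀ f, SmoothPeriodic f → ∀ τ : ℝ,
      HasDerivAt (fun τ : ℝ => ∫ t, K t * torusLift
        (smoothingOp L fun x => f (x + τ • fun i => Ω i / (2 * π))) t)
      (f (τ • fun i => Ω i / (2 * π)) - UnitAddTorus.mFourierCoeff (torusLift f) 0) τ := by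
  obtain ⟨C, k, hCk⟩ := hΩ.exists_inv_abs_le
  set R : (Fin N → ℤ) → ℝ := smoothingSymbol (List.finRange N)
  have hR : ∀ m, 1 ≤ R m := one_le_smoothingSymbol _
  have hR0 : ∀ m, 0 < R m := fun m => one_pos.trans_le (hR m)
  set freq : (Fin N → ℤ) → ℝ := fun m => ∑ i, Ω i * (m i : ℝ)
  let L := (List.replicate (k + 1) (List.finRange N)).flatten
  have hL : ∀ m, smoothingSymbol L m = R m ^ (k + 1) := smoothingSymbol_flatten_replicate _ _
  let a : (Fin N → ℤ) → ℂ := fun m =>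
    if m = 0 then 0 else (Complex.I * (freq m : ℂ) * (R m : ℂ) ^ (k + 1))⁻¹
  have ha : Summable fun m => ‖a m‖ := by
    refine Summable.of_nonneg_of_le (fun m => norm_nonneg _) (fun m => ?_)
      ((summable_inv_smoothingSymbol_finRange (N := N)).mul_left |C|)
    by_cases hm : m = 0
    · simp only [a, hm, if_true, norm_zero]
      have := hR0 0
      positivity
    · simp only [a, hm, if_false, norm_inv, norm_mul, Complex.norm_I, Complex.norm_real,
        Real.norm_eq_abs, norm_pow, abs_of_pos (hR0 m), mul_inv]
      rw [inv_one, one_mul]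
      calc |freq m|⁻¹ * (R m ^ (k + 1))⁻¹ ≤ C * R m ^ k * (R m ^ (k + 1))⁻¹ := by
            have := hR0 m
            gcongr
            exact (hCk m hm).2
        _ = C * (R m)⁻¹ := by
            have := (hR0 m).ne'
            field_simp
            ring
        _ ≤ |C| * (R m)⁻¹ := by
            have := hR0 m
            gcongr
            exact le_abs_self C
  have hK : Summable fun m => a m • UnitAddTorus.mFourier (-m) := by
    refine Summable.of_norm ?_
    simpa only [norm_smul, UnitAddTorus.mFourier_norm, mul_one] using ha
  let K : C(UnitAddTorus (Fin N), ℂ) := ∑' m, a m • UnitAddTorus.mFourier (-m)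
  refine ⟨L, K, fun f hf τ => ?_⟩
  set w : Fin N → ℝ := fun i => Ω i / (2 * π)
  set c := UnitAddTorus.mFourierCoeff (torusLift f) with hc
  have hexp : ∀ (m : Fin N → ℤ) (τ : ℝ), UnitAddTorus.mFourier m (torusMk (τ • w))
      = Complex.exp (Complex.I * freq m * τ) := by
    intro m τ
    rw [mFourier_torusMk]
    congr 1
    have : (∑ i, (m i : ℝ) * (τ • w) i) = τ * freq m / (2 * π) := by
      rw [Finset.mul_sum, Finset.sum_div]
      exact Finset.sum_congr rfl fun i _ => by simp only [Pi.smul_apply, smul_eq_mul, w]; ring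
    rw [this]
    push_cast
    have := Real.pi_ne_zero
    field_simp
  have hcoef : ∀ (m : Fin N → ℤ) (τ : ℝ), UnitAddTorus.mFourierCoeff
      (torusLift fun x => f (x + τ • w)) m = Complex.exp (Complex.I * freq m * τ) * c m :=
    fun m τ => by rw [hf.mFourierCoeff_translate, hexp]
  have hcs : Summable fun m => ‖c m‖ := by
    obtain ⟨B, hB⟩ := (hf.smoothingOp L).exists_norm_torusLift_le
    refine Summable.of_nonneg_of_le (fun m => norm_nonneg _) (fun m => ?_)
      ((summable_inv_smoothingSymbol_finRange (N := N)).mul_left |B|)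
    have h1 : ‖UnitAddTorus.mFourierCoeff (torusLift (smoothingOp L f)) m‖ ≤ B := by
      rw [UnitAddTorus.mFourierCoeff]
      refine (norm_integral_le_of_norm_le_const (C := B) (ae_of_all _ fun t => ?_)).trans_eq
        (by simp)
      rw [norm_smul]
      refine (mul_le_of_le_one_left (norm_nonneg _) ?_).trans (hB t)
      exact ((UnitAddTorus.mFourier (-m)).norm_coe_le_norm t).trans UnitAddTorus.mFourier_norm.le
    rw [hf.mFourierCoeff_smoothingOp, norm_mul, Complex.norm_real, Real.norm_eq_abs, hL,
      abs_of_pos (pow_pos (hR0 m) _)] at h1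
    change ‖c m‖ ≤ |B| * (R m)⁻¹
    rw [← div_eq_mul_inv, le_div_iff₀ (hR0 m), mul_comm]
    refine le_trans ?_ (h1.trans (le_abs_self B))
    gcongr
    exact le_self_pow₀ (hR m) (by simp)
  -- the pairing with the kernel, as a Fourier series in the time `τ`
  let g : (Fin N → ℤ) → ℝ → ℂ := fun m τ =>
    if m = 0 then 0 else (Complex.I * (freq m : ℂ))⁻¹ * (Complex.exp (Complex.I * freq m * τ) * c m)
  have hpair : ∀ τ : ℝ, HasSum (fun m => g m τ)
      (∫ t, K t * torusLift (smoothingOp L fun x => f (x + τ • w)) t) := by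
    intro τ
    have hfτ := hf.translate (τ • w)
    have hG := (hfτ.smoothingOp L).continuous_torusLift
    set G := torusLift (smoothingOp L fun x => f (x + τ • w))
    have hint : ∀ H : C(UnitAddTorus (Fin N), ℂ), Integrable fun t => H t * G t := fun H =>
      ((map_continuous H).mul hG).integrable_of_hasCompactSupport
        (HasCompactSupport.of_compactSpace _)
    obtain ⟨B, hB⟩ := (hfτ.smoothingOp L).exists_norm_torusLift_le
    let I : C(UnitAddTorus (Fin N), ℂ) →L[ℂ] ℂ := LinearMap.mkContinuous
      { toFun := fun H => ∫ t, H t * G t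
        map_add' := fun H₁ H₂ => by
          simp only [ContinuousMap.add_apply, add_mul]
          exact integral_add (hint H₁) (hint H₂)
        map_smul' := fun r H => by
          simp only [ContinuousMap.smul_apply, smul_eq_mul, mul_assoc, RingHom.id_apply]
          exact integral_const_mul _ _ } B (fun H => by
        refine (norm_integral_le_of_norm_le_const (C := B * ‖H‖) (ae_of_all _ fun t => ?_)).trans_eq
          (by simp)
        rw [norm_mul, mul_comm]
        exact mul_le_mul (hB t) (H.norm_coe_le_norm t) (norm_nonneg _)
          ((norm_nonneg _).trans (hB t)))
    have h1 : HasSum _ (∫ t, K t * G t) := I.hasSum hK.hasSum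
    refine h1.congr_fun fun m => ?_
    have h2 : I (UnitAddTorus.mFourier (-m)) = R m ^ (k + 1) *
        (Complex.exp (Complex.I * freq m * τ) * c m) := by
      have h3 := hfτ.mFourierCoeff_smoothingOp L m
      rw [hcoef, hL] at h3
      push_cast at h3
      exact h3
    rw [map_smul, h2]
    by_cases hm : m = 0
    · simp [g, a, hm]
    · have h4 : (R m : ℂ) ≠ 0 := by exact_mod_cast (hR0 m).ne'
      simp only [g, a, hm, if_false, smul_eq_mul, mul_inv]
      field_simp
  let g' : (Fin N → ℤ) → ℝ → ℂ := fun m τ =>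
    if m = 0 then 0 else Complex.exp (Complex.I * freq m * τ) * c m
  have hgg' : ∀ m (y : ℝ), HasDerivAt (g m) (g' m y) y := by
    intro m y
    by_cases hm : m = 0
    · have h1 : g m = fun _ => (0 : ℂ) := by funext y; simp [g, hm]
      have h2 : g' m y = 0 := by simp [g', hm]
      rw [h1, h2]
      exact hasDerivAt_const y (0 : ℂ)
    · have h0 : (freq m : ℂ) ≠ 0 := by exact_mod_cast (hCk m hm).1
      have h1 : HasDerivAt (fun y : ℝ => Complex.I * freq m * (y : ℂ)) (Complex.I * freq m) y := by
        simpa using (Complex.ofRealCLM.hasDerivAt (x := y)).const_mul (Complex.I * freq m)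
      have h2 := (h1.cexp.mul_const (c m)).const_mul (Complex.I * (freq m : ℂ))⁻¹
      simp only [g, g', hm, if_false]
      refine h2.congr_deriv ?_
      have := Complex.I_ne_zero
      field_simp
  have hbound : ∀ m (y : ℝ), ‖g' m y‖ ≤ ‖c m‖ := by
    intro m y
    by_cases hm : m = 0
    · simp [g', hm]
    · simp only [g', hm, if_false, norm_mul]
      have : ‖Complex.exp (Complex.I * freq m * y)‖ = 1 := by
        rw [mul_assoc, mul_comm, ← Complex.ofReal_mul, Complex.norm_exp_ofReal_mul_I]
      rw [this, one_mul]
  have hder := hasDerivAt_tsum hcs hgg' hbound (hpair 0).summable τ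
  have hfun : (fun τ : ℝ => ∫ t, K t * torusLift (smoothingOp L fun x => f (x + τ • w)) t)
      = fun τ => ∑' m, g m τ := funext fun τ => (hpair τ).tsum_eq.symm
  rw [hfun]
  refine hder.congr_deriv ?_
  have hfτ := hf.translate (τ • w)
  have h1 := UnitAddTorus.hasSum_mFourier_series_apply_of_summable
    (f := ⟨torusLift f, hf.continuous_torusLift⟩) (Summable.of_norm hcs) (torusMk (τ • w))
  simp only [ContinuousMap.coe_mk, hf.torusLift_mk, hexp, smul_eq_mul] at h1
  have h2 := h1.sub (hasSum_ite_eq (0 : Fin N → ℤ) (c 0))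
  refine (h2.congr_fun fun m => ?_).tsum_eq
  by_cases hm : m = 0
  · simp [g', hm, freq, hc]
  · simp [g', hm, mul_comm, hc]

end TorusFourier

/-! ### Functions that are smooth in a parameter and regular in the position -/

section Factorization

/-- Near `(θ₀, v₀)`, the function `f` is of the form `W (p θ, v)`, where `p` is smooth with values
in a finite-dimensional space and `W` is of class `C^n`. For `n = ω`, this expresses that `f` is
smooth in `θ` and analytic in `v`, locally uniformly in `θ`. The definition is stable under
differentiation in `θ` and under integration over `θ`, as a statement for each fixed `θ` would not
be. -/
def FactorsAt (n : WithTop ℕ∞) {Θ E : Type} [NormedAddCommGroup Θ] [NormedSpace ℝ Θ]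
    [NormedAddCommGroup E] [NormedSpace ℝ E] (f : Θ × E → ℂ) (θ₀ : Θ) (v₀ : E) : Prop :=
  ∃ (P : Type) (_ : NormedAddCommGroup P) (_ : NormedSpace ℝ P) (_ : FiniteDimensional ℝ P)
    (p : Θ → P) (W : P × E → ℂ) (U : Set Θ) (O : Set (P × E)),
    (IsOpen U ∧ θ₀ ∈ U ∧ ContDiffOn ℝ ∞ p U) ∧
    (IsOpen O ∧ (p θ₀, v₀) ∈ O ∧ ContDiffOn ℝ n W O) ∧
    ∀ᶠ q in 𝓝 (θ₀, v₀), f q = W (p q.1, q.2)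

namespace FactorsAt

variable {n : WithTop ℕ∞} {Θ E : Type} [NormedAddCommGroup Θ] [NormedSpace ℝ Θ]
    [NormedAddCommGroup E] [NormedSpace ℝ E] {f g : Θ × E → ℂ} {θ₀ : Θ} {v₀ : E}

theorem sub (hf : FactorsAt n f θ₀ v₀) (hg : FactorsAt n g θ₀ v₀) :
    FactorsAt n (fun q => f q - g q) θ₀ v₀ := by
  obtain ⟨P, _, _, _, p, W, U, O, ⟨hU, hθU, hp⟩, ⟨hO, hpO, hW⟩, hfW⟩ := hf
  obtain ⟨P', _, _, _, p', W', U', O', ⟨hU', hθU', hp'⟩, ⟨hO', hpO', hW'⟩, hgW⟩ := hg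
  refine ⟨P × P', inferInstance, inferInstance, inferInstance, fun θ => (p θ, p' θ),
    fun q => W (q.1.1, q.2) - W' (q.1.2, q.2), U ∩ U',
    (fun q => (q.1.1, q.2)) ⁻¹' O ∩ (fun q => (q.1.2, q.2)) ⁻¹' O',
    ⟨hU.inter hU', ⟨hθU, hθU'⟩, (hp.mono Set.inter_subset_left).prodMk
      (hp'.mono Set.inter_subset_right)⟩, ⟨?_, ⟨hpO, hpO'⟩, ?_⟩, ?_⟩
  · exact (hO.preimage (by fun_prop)).inter (hO'.preimage (by fun_prop))
  · exact (hW.comp (by fun_prop) fun q hq => hq.1).sub (hW'.comp (by fun_prop) fun q hq => hq.2)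
  · filter_upwards [hfW, hgW] with q h1 h2
    rw [h1, h2]

theorem fderiv_fst (hn : n + 1 ≤ n) (hf : FactorsAt n f θ₀ v₀) (w : Θ) :
    FactorsAt n (fun q => fderiv ℝ (fun θ => f (θ, q.2)) q.1 w) θ₀ v₀ := by
  obtain ⟨P, _, _, _, p, W, U, O, ⟨hU, hθU, hp⟩, ⟨hO, hpO, hW⟩, hfW⟩ := hf
  refine ⟨P × P, inferInstance, inferInstance, inferInstance, fun θ => (p θ, fderiv ℝ p θ w),
    fun q => fderiv ℝ W (q.1.1, q.2) (q.1.2, 0), U, (fun q => (q.1.1, q.2)) ⁻¹' O,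
    ⟨hU, hθU, hp.prodMk ((hp.fderiv_of_isOpen hU (m := ∞) (by simp)).clm_apply contDiffOn_const)⟩,
    ⟨hO.preimage (by fun_prop), hpO, ?_⟩, ?_⟩
  · exact ContDiffOn.clm_apply ((hW.fderiv_of_isOpen hO hn).comp (by fun_prop) fun q hq => hq)
      (by fun_prop)
  · have hne : n ≠ 0 := by rintro rfl; simp at hn
    have hcont : ContinuousAt (fun q : Θ × E => (p q.1, q.2)) (θ₀, v₀) :=
      ((hp.continuousOn.continuousAt (hU.mem_nhds hθU)).comp continuousAt_fst).prodMk
        continuousAt_snd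
    filter_upwards [hfW.eventually_nhds, hcont.preimage_mem_nhds (hO.mem_nhds hpO),
      continuousAt_fst.preimage_mem_nhds (hU.mem_nhds hθU)] with q h1 h2 h3
    have hslice : ContinuousAt (fun θ => (θ, q.2)) q.1 := by fun_prop
    have h4 : (fun θ => f (θ, q.2)) =ᶠ[𝓝 q.1] fun θ => W (p θ, q.2) := hslice.eventually h1
    have h5 : HasFDerivAt p (fderiv ℝ p q.1) q.1 :=
      ((hp.contDiffAt (hU.mem_nhds h3)).differentiableAt (by simp)).hasFDerivAt
    have h6 : HasFDerivAt W (fderiv ℝ W (p q.1, q.2)) (p q.1, q.2) :=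
      ((hW.contDiffAt (hO.mem_nhds h2)).differentiableAt hne).hasFDerivAt
    have h7 := h6.comp (f := fun θ => (p θ, q.2)) q.1 (h5.prodMk (hasFDerivAt_const q.2 q.1))
    rw [h4.fderiv_eq]
    change fderiv ℝ (W ∘ fun θ => (p θ, q.2)) q.1 w = _
    rw [h7.fderiv]
    simp

theorem smoothingOp {N : ℕ} (hn : n + 1 ≤ n) {f : (Fin N → ℝ) × E → ℂ} {θ₀ : Fin N → ℝ}
    (hf : FactorsAt n f θ₀ v₀) (L : List (Fin N)) :
    FactorsAt n (fun q => _root_.smoothingOp L (fun θ => f (θ, q.2)) q.1) θ₀ v₀ := by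
  induction L with
  | nil => exact hf
  | cons i L ih =>
    exact ih.sub ((ih.fderiv_fst hn (Pi.single i 1)).fderiv_fst hn (Pi.single i 1))

/-- The local form of `contDiffAt_setIntegral`. On a set `B` close to `θ₀` the integrand is a
regular function of `v` and of the parameter `(K θ, p θ)`; off `B` the parameter is frozen at its
value at `θ₀`, so that it takes its values in a small ball. -/
theorem exists_contDiffAt_setIntegral [MeasurableSpace Θ] [BorelSpace Θ] [FiniteDimensional ℝ Θ]
    [FiniteDimensional ℝ E] {μ : Measure Θ} [IsLocallyFiniteMeasure μ]
    (hn : n = ∞ ∨ n = ω) (hf : FactorsAt n f θ₀ v₀) {K : Θ → ℂ} (hK : Continuous K) :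
    ∃ A ∈ 𝓝 θ₀, IsClosed A ∧ ∀ B ⊆ A, MeasurableSet B →
      ContDiffAt ℝ n (fun v => ∫ θ in B, K θ * f (θ, v) ∂μ) v₀ := by
  obtain ⟨P, _, _, _, p, W, U, O, ⟨hU, hθU, hp⟩, ⟨hO, hpO, hW⟩, hfW⟩ := hf
  let _ : MeasurableSpace P := borel P
  have : BorelSpace P := ⟨rfl⟩
  have := FiniteDimensional.proper_real P
  have := FiniteDimensional.proper_real Θ
  have hW₁ : ContDiffOn ℝ n (fun q : (ℂ × P) × E => q.1.1 * W (q.1.2, q.2))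
      ((fun q => (q.1.2, q.2)) ⁻¹' O) :=
    ContDiffOn.mul (by fun_prop) (hW.comp (by fun_prop) fun q hq => hq)
  have hO₁ : ((fun q : (ℂ × P) × E => (q.1.2, q.2)) ⁻¹' O) ∈ 𝓝 ((K θ₀, p θ₀), v₀) :=
    (hO.preimage (by fun_prop)).mem_nhds hpO
  obtain ⟨ε, hε, H⟩ := hW₁.exists_contDiffAt_integral hn hO₁
  have hKp : ContinuousOn (fun θ => (K θ, p θ)) U := hK.continuousOn.prodMk hp.continuousOn
  obtain ⟨δ₁, hδ₁, h1⟩ := Metric.eventually_nhds_iff_ball.1 hfW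
  obtain ⟨δ₂, hδ₂, h2⟩ := Metric.mem_nhds_iff.1 (Filter.inter_mem (hU.mem_nhds hθU)
    ((hKp.continuousAt (hU.mem_nhds hθU)).preimage_mem_nhds (Metric.closedBall_mem_nhds _ hε)))
  have hmin : 0 < min δ₁ δ₂ := lt_min hδ₁ hδ₂
  have hAsub : Metric.closedBall θ₀ (min δ₁ δ₂ / 2) ⊆ Metric.ball θ₀ (min δ₁ δ₂) :=
    Metric.closedBall_subset_ball (half_lt_self hmin)
  refine ⟨Metric.closedBall θ₀ (min δ₁ δ₂ / 2), Metric.closedBall_mem_nhds _ (by positivity),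
    Metric.isClosed_closedBall, fun B hB hBm => ?_⟩
  have hB2 : ∀ θ ∈ B, θ ∈ U ∧ (K θ, p θ) ∈ Metric.closedBall (K θ₀, p θ₀) ε := fun θ hθ =>
    h2 (Metric.ball_subset_ball (min_le_right _ _) (hAsub (hB hθ)))
  have hfin : IsFiniteMeasure (μ.restrict B) := by
    refine ⟨?_⟩
    rw [Measure.restrict_apply_univ]
    exact (measure_mono hB).trans_lt (isCompact_closedBall _ _).measure_lt_top
  classical
  have h3 := H (μ.restrict B) (B.piecewise (fun θ => (K θ, p θ)) fun _ => (K θ₀, p θ₀))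
    ((hKp.mono fun θ hθ => (hB2 θ hθ).1).measurable_piecewise continuousOn_const hBm)
    (fun θ => by
      by_cases hθ : θ ∈ B
      · rw [Set.piecewise_eq_of_mem _ _ _ hθ]
        exact (hB2 θ hθ).2
      · rw [Set.piecewise_eq_of_notMem _ _ _ hθ]
        exact Metric.mem_closedBall_self hε.le)
  refine h3.congr_of_eventuallyEq ?_
  filter_upwards [Metric.ball_mem_nhds v₀ hδ₁] with v hv
  refine setIntegral_congr_fun hBm fun θ hθ => ?_
  simp only [Set.piecewise_eq_of_mem _ _ _ hθ]
  rw [h1 (θ, v) (by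
    rw [← ball_prod_same]
    exact ⟨Metric.ball_subset_ball (min_le_left _ _) (hAsub (hB hθ)), hv⟩)]

/-- The integral over `θ` of a function that factors near each point of a compact set is as regular
in `v` as the factorizations; the compact set is covered by finitely many pieces on each of which
`exists_contDiffAt_setIntegral` applies. -/
theorem contDiffAt_setIntegral [MeasurableSpace Θ] [BorelSpace Θ] [FiniteDimensional ℝ Θ]
    [FiniteDimensional ℝ E] {μ : Measure Θ} [IsLocallyFiniteMeasure μ]
    (hn : n = ∞ ∨ n = ω) {S : Set Θ} (hS : IsCompact S) (hf : ∀ θ ∈ S, FactorsAt n f θ v₀)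
    (hcont : ∀ v, Continuous fun θ => f (θ, v)) {K : Θ → ℂ} (hK : Continuous K)
    {B : Set Θ} (hB : B ⊆ S) (hBm : MeasurableSet B) :
    ContDiffAt ℝ n (fun v => ∫ θ in B, K θ * f (θ, v) ∂μ) v₀ := by
  have hint : ∀ v, ∀ B ⊆ S, IntegrableOn (fun θ => K θ * f (θ, v)) B μ := fun v B hB =>
    ((hK.mul (hcont v)).continuousOn.integrableOn_compact hS).mono_set hB
  have key : ∃ A, S ⊆ A ∧ MeasurableSet A ∧ ∀ B ⊆ A, B ⊆ S → MeasurableSet B →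
      ContDiffAt ℝ n (fun v => ∫ θ in B, K θ * f (θ, v) ∂μ) v₀ := by
    refine hS.induction_on (p := fun T => ∃ A, T ⊆ A ∧ MeasurableSet A ∧ ∀ B ⊆ A, B ⊆ S →
      MeasurableSet B → ContDiffAt ℝ n (fun v => ∫ θ in B, K θ * f (θ, v) ∂μ) v₀) ?_ ?_ ?_ ?_
    · refine ⟨∅, subset_rfl, .empty, fun B hB _ _ => ?_⟩
      rw [Set.subset_empty_iff.1 hB]
      simp only [Measure.restrict_empty, integral_zero_measure]
      exact contDiffAt_const
    · rintro T T' hT ⟨A, hA, h⟩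
      exact ⟨A, hT.trans hA, h⟩
    · rintro T T' ⟨A, hTA, hA, h⟩ ⟨A', hTA', hA', h'⟩
      refine ⟨A ∪ A', Set.union_subset_union hTA hTA', hA.union hA', fun B hB hBS hBm => ?_⟩
      have h1 := h (B ∩ A) Set.inter_subset_right (Set.inter_subset_left.trans hBS) (hBm.inter hA)
      have h2 := h' (B \ A) (fun θ hθ => (hB hθ.1).resolve_left hθ.2)
        (Set.sdiff_subset.trans hBS) (hBm.diff hA)
      have h3 : (fun v => ∫ θ in B, K θ * f (θ, v) ∂μ) = fun v =>
          (∫ θ in B ∩ A, K θ * f (θ, v) ∂μ) + ∫ θ in B \ A, K θ * f (θ, v) ∂μ := funext fun v =>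
        (integral_inter_add_sdiff hA (hint v B hBS)).symm
      rw [h3]
      exact h1.add h2
    · intro θ hθ
      obtain ⟨A, hA, hAc, h⟩ := (hf θ hθ).exists_contDiffAt_setIntegral (μ := μ) hn hK
      exact ⟨A, mem_nhdsWithin_of_mem_nhds hA, A, subset_rfl, hAc.measurableSet,
        fun B hB _ hBm => h B hB hBm⟩
  obtain ⟨A, hSA, -, h⟩ := key
  exact h B (hB.trans hSA) hB hBm

end FactorsAt

end Factorization

/-! ### The metric in a chart -/

section MetricInChart

variable {d : ℕ} {M : Type*} [TopologicalSpace M] [ChartedSpace (EuclideanSpace ℝ (Fin d)) M]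

/-- The squared length of a tangent vector. It is a function on the total space of the tangent
bundle, so that vectors at points that are only propositionally equal can be compared. -/
noncomputable def tangentNormSq [RiemannianBundle (fun x : M => TangentSpace (𝓡 d) x)]
    (z : TangentBundle (𝓡 d) M) : ℝ :=
  inner ℝ (z.2 : TangentSpace (𝓡 d) z.1) z.2

theorem tangentMap_congr {f g : EuclideanSpace ℝ (Fin d) → M} {v : EuclideanSpace ℝ (Fin d)}
    (h : f =ᶠ[𝓝 v] g) (a : EuclideanSpace ℝ (Fin d)) :
    tangentMap 𝓘(ℝ, EuclideanSpace ℝ (Fin d)) (𝓡 d) f ⟨v, a⟩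
      = tangentMap 𝓘(ℝ, EuclideanSpace ℝ (Fin d)) (𝓡 d) g ⟨v, a⟩ := by
  have key : ∀ (y y' : M) (X X' : EuclideanSpace ℝ (Fin d)), y = y' → X = X' →
      (⟨y, X⟩ : TangentBundle (𝓡 d) M) = ⟨y', X'⟩ := by
    rintro y y' X X' rfl rfl
    rfl
  exact key _ _ _ _ h.self_of_nhds (DFunLike.congr_fun
    (h.mfderiv_eq (I := 𝓘(ℝ, EuclideanSpace ℝ (Fin d))) (I' := 𝓡 d)) a)

/-- The matrix `G` of an analytic Riemannian metric in a chart, characterized through the lengths of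
the images of the coordinate vectors under the inverse of the chart. -/
theorem exists_metricInChart [IsManifold (𝓡 d) ω M]
    [RiemannianBundle (fun x : M => TangentSpace (𝓡 d) x)]
    [IsContMDiffRiemannianBundle (𝓡 d) ω (EuclideanSpace ℝ (Fin d))
      (fun x : M => TangentSpace (𝓡 d) x)] (x₀ : M) :
    ∃ G : EuclideanSpace ℝ (Fin d) → EuclideanSpace ℝ (Fin d) →L[ℝ]
        EuclideanSpace ℝ (Fin d) →L[ℝ] ℝ,
      ContDiffOn ℝ ω G (extChartAt (𝓡 d) x₀).target ∧
      (∀ v a b, G v a b = G v b a) ∧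
      (∀ v ∈ (extChartAt (𝓡 d) x₀).target, ∀ a, a ≠ 0 → 0 < G v a a) ∧
      ∀ v ∈ (extChartAt (𝓡 d) x₀).target, ∀ a, G v a a = tangentNormSq (tangentMap
        𝓘(ℝ, EuclideanSpace ℝ (Fin d)) (𝓡 d) (extChartAt (𝓡 d) x₀).symm ⟨v, a⟩) := by
  obtain ⟨g, -, hg⟩ := ‹IsContMDiffRiemannianBundle (𝓡 d) ω (EuclideanSpace ℝ (Fin d))
    (fun x : M => TangentSpace (𝓡 d) x)›.exists_contMDiff
  set e := extChartAt (𝓡 d) x₀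
  have hopen : IsOpen e.target := isOpen_extChartAt_target x₀
  let D : ∀ v : EuclideanSpace ℝ (Fin d), EuclideanSpace ℝ (Fin d) →L[ℝ]
      TangentSpace (𝓡 d) (e.symm v) := fun v =>
    mfderiv 𝓘(ℝ, EuclideanSpace ℝ (Fin d)) (𝓡 d) e.symm v
  let G : EuclideanSpace ℝ (Fin d) → EuclideanSpace ℝ (Fin d) →L[ℝ]
        EuclideanSpace ℝ (Fin d) →L[ℝ] ℝ := fun v => (g (e.symm v)).bilinearComp (D v) (D v)
  have hG : ∀ v a b, G v a b = inner ℝ (D v a) (D v b) := fun v a b => (hg _ _ _).symm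
  refine ⟨G, ?_, fun v a b => ?_, fun v hv a ha => ?_, fun v _ a => hG v a a⟩
  · rw [contDiffOn_clm_apply]
    intro a
    rw [contDiffOn_clm_apply]
    intro b
    have hsec : ∀ a : EuclideanSpace ℝ (Fin d), ContMDiffOn 𝓘(ℝ, EuclideanSpace ℝ (Fin d))
        (𝓡 d).tangent ω (fun v => (⟨e.symm v, D v a⟩ : TangentBundle (𝓡 d) M)) e.target := by
      intro a
      have h1 := (contMDiffOn_extChartAt_symm (I := 𝓡 d) (n := ω) x₀).contMDiffOn_tangentMapWithin
        (m := ω) (by simp) hopen.uniqueMDiffOn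
      have h2 : ContMDiff 𝓘(ℝ, EuclideanSpace ℝ (Fin d)) 𝓘(ℝ, EuclideanSpace ℝ (Fin d)).tangent ω
          (fun v => (⟨v, a⟩ : TangentBundle 𝓘(ℝ, EuclideanSpace ℝ (Fin d))
            (EuclideanSpace ℝ (Fin d)))) := by
        intro v
        rw [contMDiffAt_totalSpace]
        refine ⟨contMDiffAt_id, ?_⟩
        simpa using contMDiffAt_const
      refine (h1.comp h2.contMDiffOn fun v hv => hv).congr fun v hv => ?_
      have h4 : mfderivWithin 𝓘(ℝ, EuclideanSpace ℝ (Fin d)) (𝓡 d) e.symm e.target v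
          = mfderiv 𝓘(ℝ, EuclideanSpace ℝ (Fin d)) (𝓡 d) e.symm v :=
        mfderivWithin_of_isOpen hopen hv
      exact congrArg (fun T : TangentSpace 𝓘(ℝ, EuclideanSpace ℝ (Fin d)) v →L[ℝ]
        TangentSpace (𝓡 d) (e.symm v) => (⟨e.symm v, T a⟩ : TangentBundle (𝓡 d) M)) h4.symm
    have h3 := ContMDiffOn.inner_bundle (hsec a) (hsec b)
    exact (contMDiffOn_iff_contDiffOn.1 h3).congr fun v _ => hG v a b
  · rw [hG, hG, real_inner_comm]
  · rw [hG]
    have hinv : (D v).IsInvertible := by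
      have h1 := isInvertible_mfderivWithin_extChartAt_symm (I := 𝓡 d) hv
      rwa [modelWithCornersSelf_coe, Set.range_id, mfderivWithin_univ] at h1
    refine real_inner_self_pos.2 fun h => ha ?_
    exact hinv.injective (h.trans (map_zero (D v)).symm)

end MetricInChart

/-! ### Families of isometries in charts -/

section ActionInChart

variable {d : ℕ} {M : Type*} [TopologicalSpace M] [ChartedSpace (EuclideanSpace ℝ (Fin d)) M]
  {Θ : Type} [NormedAddCommGroup Θ] [NormedSpace ℝ Θ] {A : Θ → M → M}

theorem contMDiffOn_comp_extChartAt_symm [IsManifold (𝓡 d) ∞ M]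
    (hA : ContMDiff (𝓘(ℝ, Θ).prod (𝓡 d)) (𝓡 d) ∞ (fun p : Θ × M => A p.1 p.2)) (x₀ : M) :
    ContMDiffOn 𝓘(ℝ, Θ × EuclideanSpace ℝ (Fin d)) (𝓡 d) ∞
      (fun q : Θ × EuclideanSpace ℝ (Fin d) => A q.1 ((extChartAt (𝓡 d) x₀).symm q.2))
      (Set.univ ×ˢ (extChartAt (𝓡 d) x₀).target) := by
  have h1 : ContMDiffOn 𝓘(ℝ, Θ × EuclideanSpace ℝ (Fin d)) (𝓘(ℝ, Θ).prod (𝓡 d)) ∞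
      (fun q : Θ × EuclideanSpace ℝ (Fin d) => (q.1, (extChartAt (𝓡 d) x₀).symm q.2))
      (Set.univ ×ˢ (extChartAt (𝓡 d) x₀).target) := by
    refine ContMDiffOn.prodMk contDiff_fst.contMDiff.contMDiffOn ?_
    exact (contMDiffOn_extChartAt_symm x₀).comp contDiff_snd.contMDiff.contMDiffOn
      fun q hq => hq.2
  exact hA.comp_contMDiffOn h1

/-- A smooth function composed with a smooth family of maps is smooth in all variables: here the
parameter `p` of the factorization is the identity. -/
theorem factorsAt_smooth_action [IsManifold (𝓡 d) ∞ M] [FiniteDimensional ℝ Θ]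
    (hA : ContMDiff (𝓘(ℝ, Θ).prod (𝓡 d)) (𝓡 d) ∞ (fun p : Θ × M => A p.1 p.2))
    {J : M → ℝ} (hJ : ContMDiff (𝓡 d) 𝓘(ℝ, ℝ) ∞ J) (x₀ : M) (θ₀ : Θ) :
    FactorsAt ∞ (fun q : Θ × EuclideanSpace ℝ (Fin d) =>
      (J (A q.1 ((extChartAt (𝓡 d) x₀).symm q.2)) : ℂ)) θ₀ (extChartAt (𝓡 d) x₀ x₀) := by
  refine ⟨Θ, inferInstance, inferInstance, inferInstance, id, fun q =>
    (J (A q.1 ((extChartAt (𝓡 d) x₀).symm q.2)) : ℂ), Set.univ,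
    Set.univ ×ˢ (extChartAt (𝓡 d) x₀).target, ⟨isOpen_univ, trivial, contDiffOn_id⟩,
    ⟨isOpen_univ.prod (isOpen_extChartAt_target x₀), ⟨trivial, mem_extChartAt_target x₀⟩, ?_⟩,
    Eventually.of_forall fun q => rfl⟩
  exact Complex.ofRealCLM.contDiff.comp_contDiffOn
    (contMDiffOn_iff_contDiffOn.1 (hJ.comp_contMDiffOn (contMDiffOn_comp_extChartAt_symm hA x₀)))

/-- In charts, a smooth family of isometries of an analytic Riemannian manifold is analytic in the
position, locally uniformly in the parameter, by `exists_analyticAt_of_isometry_family`: the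
parameter `p` of the factorization is the `1`-jet of the isometry at the centre of the chart. -/
theorem factorsAt_isometric_action [IsManifold (𝓡 d) ∞ M] [IsManifold (𝓡 d) ω M]
    [RiemannianBundle (fun x : M => TangentSpace (𝓡 d) x)]
    [IsContMDiffRiemannianBundle (𝓡 d) ω (EuclideanSpace ℝ (Fin d))
      (fun x : M => TangentSpace (𝓡 d) x)] [FiniteDimensional ℝ Θ]
    (hA : ContMDiff (𝓘(ℝ, Θ).prod (𝓡 d)) (𝓡 d) ∞ (fun p : Θ × M => A p.1 p.2))
    (hiso : ∀ θ z, tangentNormSq (tangentMap (𝓡 d) (𝓡 d) (A θ) z) = tangentNormSq z)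
    {J : M → ℝ} (hJ : ContMDiff (𝓡 d) 𝓘(ℝ, ℝ) ω J) (x₀ : M) (θ₀ : Θ) :
    FactorsAt ω (fun q : Θ × EuclideanSpace ℝ (Fin d) =>
      (J (A q.1 ((extChartAt (𝓡 d) x₀).symm q.2)) : ℂ)) θ₀ (extChartAt (𝓡 d) x₀ x₀) := by
  set e := extChartAt (𝓡 d) x₀ with he
  set y₀ := A θ₀ x₀ with hy₀
  set e' := extChartAt (𝓡 d) y₀ with he'
  set v₀ := e x₀ with hv₀
  have hv₀t : v₀ ∈ e.target := mem_extChartAt_target x₀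
  have hev₀ : e.symm v₀ = x₀ := extChartAt_to_inv x₀
  have het : IsOpen e.target := isOpen_extChartAt_target x₀
  have het' : IsOpen e'.target := isOpen_extChartAt_target y₀
  -- the action in the charts `e` at `x₀` and `e'` at `y₀`, defined on `O`
  let B : Θ × EuclideanSpace ℝ (Fin d) → M := fun q => A q.1 (e.symm q.2)
  let f : Θ × EuclideanSpace ℝ (Fin d) → EuclideanSpace ℝ (Fin d) := fun q => e' (B q)
  have hB : ContMDiffOn 𝓘(ℝ, Θ × EuclideanSpace ℝ (Fin d)) (𝓡 d) ∞ B (Set.univ ×ˢ e.target) :=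
    contMDiffOn_comp_extChartAt_symm hA x₀
  let O : Set (Θ × EuclideanSpace ℝ (Fin d)) := (Set.univ ×ˢ e.target) ∩ B ⁻¹' e'.source
  have hO : IsOpen O :=
    hB.continuousOn.isOpen_inter_preimage (isOpen_univ.prod het) (isOpen_extChartAt_source y₀)
  have hmem : (θ₀, v₀) ∈ O := by
    refine ⟨⟨trivial, hv₀t⟩, ?_⟩
    change A θ₀ (e.symm v₀) ∈ e'.source
    rw [hev₀]
    exact mem_extChartAt_source y₀
  have hf : ContDiffOn ℝ ∞ f O := by
    rw [← contMDiffOn_iff_contDiffOn]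
    exact (contMDiffOn_extChartAt (n := ∞)).comp (hB.mono Set.inter_subset_left)
      fun q hq => by simpa [e'] using hq.2
  have hfB : ∀ q ∈ O, e'.symm (f q) = B q := fun q hq => e'.left_inv hq.2
  have hft : ∀ q ∈ O, f q ∈ e'.target := fun q hq => e'.map_source hq.2
  obtain ⟨G, hG, hGs, hGp, hGn⟩ := exists_metricInChart (d := d) (M := M) x₀
  obtain ⟨G', hG', hGs', hGp', hGn'⟩ := exists_metricInChart (d := d) (M := M) y₀
  have hquad : ∀ q ∈ O, ∀ a, G' (f q) (fderiv ℝ (fun w => f (q.1, w)) q.2 a)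
      (fderiv ℝ (fun w => f (q.1, w)) q.2 a) = G q.2 a a := by
    rintro ⟨θ, v⟩ hq a
    have hv : v ∈ e.target := hq.1.2
    have hslice : ContinuousAt (fun w => (θ, w)) v := by fun_prop
    have hfd : MDifferentiableAt 𝓘(ℝ, EuclideanSpace ℝ (Fin d)) 𝓘(ℝ, EuclideanSpace ℝ (Fin d))
        (fun w => f (θ, w)) v :=
      (((hf.contDiffAt (hO.mem_nhds hq)).comp v (by fun_prop)).differentiableAt
        (by simp)).mdifferentiableAt
    have hed : MDifferentiableAt 𝓘(ℝ, EuclideanSpace ℝ (Fin d)) (𝓡 d) e.symm v :=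
      ((contMDiffOn_extChartAt_symm (n := ∞) x₀).contMDiffAt (het.mem_nhds hv)).mdifferentiableAt
        (by simp)
    have hed' : MDifferentiableAt 𝓘(ℝ, EuclideanSpace ℝ (Fin d)) (𝓡 d) e'.symm (f (θ, v)) :=
      ((contMDiffOn_extChartAt_symm (n := ∞) y₀).contMDiffAt
        (het'.mem_nhds (hft _ hq))).mdifferentiableAt (by simp)
    have hAd : MDifferentiableAt (𝓡 d) (𝓡 d) (A θ) (e.symm v) :=
      (hA.comp (contMDiff_const.prodMk contMDiff_id : ContMDiff (𝓡 d) (𝓘(ℝ, Θ).prod (𝓡 d)) ∞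
        fun x : M => (θ, x))).mdifferentiableAt (by simp)
    have h1 : (e'.symm ∘ fun w => f (θ, w)) =ᶠ[𝓝 v] A θ ∘ e.symm :=
      (hslice.eventually (hO.mem_nhds hq)).mono fun w hw => hfB _ hw
    have h2 := tangentMap_congr h1 a
    rw [tangentMap_comp_at (I' := 𝓘(ℝ, EuclideanSpace ℝ (Fin d))) ⟨v, a⟩ hed' hfd,
      tangentMap_comp_at (I' := 𝓡 d) ⟨v, a⟩ hAd hed] at h2
    rw [hGn v hv a, ← hiso θ, ← h2, hGn' _ (hft _ hq)]
    congr 2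
    simp only [tangentMap, mfderiv_eq_fderiv]
    rfl
  -- polarization
  have hpol : ∀ q ∈ O, ∀ a b, G' (f q) (fderiv ℝ (fun w => f (q.1, w)) q.2 a)
      (fderiv ℝ (fun w => f (q.1, w)) q.2 b) = G q.2 a b := by
    intro q hq a b
    have h1 := hquad q hq (a + b)
    have h2 := hquad q hq a
    have h3 := hquad q hq b
    simp only [map_add, add_apply] at h1
    have h4 := hGs q.2 a b
    have h5 := hGs' (f q) (fderiv ℝ (fun w => f (q.1, w)) q.2 a)
      (fderiv ℝ (fun w => f (q.1, w)) q.2 b)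
    linarith
  obtain ⟨Y, hY, hfY⟩ := exists_analyticAt_of_isometry_family (f := f) (θ₀ := θ₀) (v₀ := v₀)
    (((hf.contDiffAt (hO.mem_nhds hmem))).of_le (by norm_cast))
    (hG.contDiffAt (het.mem_nhds hv₀t)).analyticAt
    (hG'.contDiffAt (het'.mem_nhds (hft _ hmem))).analyticAt
    (Eventually.of_forall hGs') (Filter.mem_of_superset (het.mem_nhds hv₀t) hGp)
    (Filter.mem_of_superset (het'.mem_nhds (hft _ hmem)) hGp')
    (Filter.mem_of_superset (hO.mem_nhds hmem) hpol)
  have hslice₀ : Continuous fun θ : Θ => (θ, v₀) := by fun_prop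
  let p : Θ → EuclideanSpace ℝ (Fin d) × 
      (EuclideanSpace ℝ (Fin d) →L[ℝ] EuclideanSpace ℝ (Fin d)) := fun θ =>
    (f (θ, v₀), fderiv ℝ (fun w => f (θ, w)) v₀)
  let W : (EuclideanSpace ℝ (Fin d) × (EuclideanSpace ℝ (Fin d) →L[ℝ] EuclideanSpace ℝ (Fin d))) ×
      EuclideanSpace ℝ (Fin d) → ℂ := fun q => (J (e'.symm (Y q)) : ℂ)
  have hJe : ContDiffOn ℝ ω (fun y => J (e'.symm y)) e'.target :=
    contMDiffOn_iff_contDiffOn.1 (hJ.comp_contMDiffOn (contMDiffOn_extChartAt_symm y₀))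
  have hW : AnalyticAt ℝ W (p θ₀, v₀) := by
    have h1 : Y (p θ₀, v₀) ∈ e'.target := by
      have := hfY.self_of_nhds
      rw [← this]
      exact hft _ hmem
    have h2 : ContDiffAt ℝ ω (fun q => J (e'.symm (Y q))) (p θ₀, v₀) :=
      ContDiffAt.comp (g := fun y => J (e'.symm y)) _ (hJe.contDiffAt (het'.mem_nhds h1))
        hY.contDiffAt
    exact (Complex.ofRealCLM.contDiff.contDiffAt.comp _ h2).analyticAt
  refine ⟨_, inferInstance, inferInstance, inferInstance, p, W, (fun θ => (θ, v₀)) ⁻¹' O,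
    {q | AnalyticAt ℝ W q}, ⟨hO.preimage hslice₀, hmem, ?_⟩,
    ⟨isOpen_analyticAt ℝ W, hW, fun q hq => hq.contDiffAt.contDiffWithinAt⟩, ?_⟩
  · have h1 : ContDiffOn ℝ ∞ (fun θ => fderiv ℝ f (θ, v₀) ∘L .inr ℝ Θ (EuclideanSpace ℝ (Fin d)))
        ((fun θ => (θ, v₀)) ⁻¹' O) :=
      ((hf.fderiv_of_isOpen hO (m := ∞) (by simp)).comp
        (f := fun θ : Θ => (θ, v₀)) (by fun_prop) fun θ hθ => hθ).clm_comp contDiffOn_const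
    refine (hf.comp (f := fun θ : Θ => (θ, v₀)) (by fun_prop) fun θ hθ => hθ).prodMk
      (h1.congr fun θ hθ => ?_)
    exact (((hf.contDiffAt (hO.mem_nhds hθ)).differentiableAt (by simp)).hasFDerivAt.comp
      (f := fun w => (θ, w)) v₀ (hasFDerivAt_prodMk_right _ _)).fderiv
  · filter_upwards [hfY, hO.mem_nhds hmem] with q h1 h2
    have h3 : e'.symm (Y (p q.1, q.2)) = B q := by
      rw [← hfB q h2]
      exact congrArg e'.symm h1.symm
    simp only [W, h3, B]

end ActionInChart

/-! ### Lie derivatives along the torus action -/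

section LieDerivative

variable {d N : ℕ} {M : Type*} [TopologicalSpace M] [ChartedSpace (EuclideanSpace ℝ (Fin d)) M]

theorem IsFlowOf.hasDerivAt_comp {φ : ℝ → M → M} {X : ∀ x : M, TangentSpace (𝓡 d) x}
    (hφ : IsFlowOf φ X) {g : M → ℝ} {t : ℝ} {x : M}
    (hg : MDifferentiableAt (𝓡 d) 𝓘(ℝ, ℝ) g (φ t x)) :
    HasDerivAt (fun t => g (φ t x)) (lieDerivative X g (φ t x)) t := by
  have h1 := hg.hasMFDerivAt.comp t (hφ.isMIntegralCurve x t)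
  let T : ℝ →L[ℝ] ℝ := (mfderiv (𝓡 d) 𝓘(ℝ, ℝ) g (φ t x)).comp
    (ContinuousLinearMap.smulRight (1 : ℝ →L[ℝ] ℝ) (X (φ t x)))
  have h2 : HasFDerivAt (fun t => g (φ t x)) T t := h1.hasFDerivAt
  refine h2.hasDerivAt.congr_deriv ?_
  change mfderiv (𝓡 d) 𝓘(ℝ, ℝ) g (φ t x) ((1 : ℝ) • X (φ t x)) = _
  rw [one_smul]
  rfl

variable [RiemannianBundle (fun x : M => TangentSpace (𝓡 d) x)]
  {Φ : EuclideanSpace ℝ (Fin N) → M → M} {ψ : Fin N → ∀ x : M, TangentSpace (𝓡 d) x}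
  {Ω : EuclideanSpace ℝ (Fin N)} {s : ∀ x : M, TangentSpace (𝓡 d) x}

namespace IsIsometricTorusAction

theorem contMDiff_orbit (hΦ : IsIsometricTorusAction d N Φ) (x : M) :
    ContMDiff 𝓘(ℝ, EuclideanSpace ℝ (Fin N)) (𝓡 d) ∞ fun σ => Φ σ x :=
  hΦ.contMDiff.comp (contMDiff_id.prodMk contMDiff_const)

theorem contMDiff_map (hΦ : IsIsometricTorusAction d N Φ) (σ : EuclideanSpace ℝ (Fin N)) :
    ContMDiff (𝓡 d) (𝓡 d) ∞ (Φ σ) :=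
  hΦ.contMDiff.comp (contMDiff_const.prodMk contMDiff_id)

/-- The field `s = ∑ Ωᵢ ψᵢ` differentiates along the one-parameter group `t ↦ Φ (t Ω)`. -/
theorem lieDerivative_eq_fderiv (hΦ : IsIsometricTorusAction d N Φ)
    (hψ : ∀ i, IsFlowOf (fun t => Φ (EuclideanSpace.single i t)) (ψ i))
    (hs : ∀ x, s x = ∑ i, Ω i • ψ i x) {g : M → ℝ} {x : M}
    (hg : MDifferentiableAt (𝓡 d) 𝓘(ℝ, ℝ) g x) :
    lieDerivative s g x = fderiv ℝ (fun σ => g (Φ σ x)) 0 Ω := by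
  have hd : DifferentiableAt ℝ (fun σ => g (Φ σ x)) 0 := by
    refine MDifferentiableAt.differentiableAt ?_
    refine MDifferentiableAt.comp (I' := 𝓡 d) 0 ?_
      ((hΦ.contMDiff_orbit x).mdifferentiableAt (by simp))
    rwa [hΦ.map_zero]
  have h1 : ∀ i, lieDerivative (ψ i) g x
      = fderiv ℝ (fun σ => g (Φ σ x)) 0 (EuclideanSpace.single i 1) := by
    intro i
    have h2 := (hψ i).hasDerivAt_comp (g := g) (t := 0) (x := x) (by
      rwa [(hψ i).map_zero])
    rw [(hψ i).map_zero] at h2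
    have h3 : HasDerivAt (fun t : ℝ => (EuclideanSpace.single i t : EuclideanSpace ℝ (Fin N)))
        (EuclideanSpace.single i 1) 0 := by
      have h4 : (fun t : ℝ => (EuclideanSpace.single i t : EuclideanSpace ℝ (Fin N)))
          = fun t => t • EuclideanSpace.single i 1 := by
        funext t
        ext j
        simp
      rw [h4]
      simpa using (hasDerivAt_id (0 : ℝ)).smul_const
        (EuclideanSpace.single i (1 : ℝ) : EuclideanSpace ℝ (Fin N))
    have h0 : (EuclideanSpace.single i (0 : ℝ) : EuclideanSpace ℝ (Fin N)) = 0 := by simp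
    have h5 : HasDerivAt (fun t => g (Φ (EuclideanSpace.single i t) x))
        (fderiv ℝ (fun σ => g (Φ σ x)) 0 (EuclideanSpace.single i 1)) 0 :=
      HasFDerivAt.comp_hasDerivAt (l := fun σ => g (Φ σ x)) 0 (by
        rw [h0]; exact hd.hasFDerivAt) h3
    exact h2.unique h5
  have h6 : lieDerivative s g x = ∑ i, Ω i * lieDerivative (ψ i) g x := by
    simp only [lieDerivative]
    rw [hs, map_sum]
    exact Finset.sum_congr rfl fun i _ => (mfderiv (𝓡 d) 𝓘(ℝ, ℝ) g x).map_smul (Ω i) (ψ i x)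
  have h7 : Ω = ∑ i, Ω i • (EuclideanSpace.single i 1 : EuclideanSpace ℝ (Fin N)) := by
    ext j
    simp [Finset.sum_apply, Pi.single_apply]
  rw [h6]
  conv_rhs => rw [h7, map_sum]
  exact Finset.sum_congr rfl fun i _ => by rw [h1, map_smul, smul_eq_mul]

/-- The flow of `s` is `t ↦ Φ (t Ω)`, tested against a smooth function, since the derivative of
`t ↦ g (Φ ((T - t) Ω) (φ t x))` vanishes. -/
theorem comp_flow_eq (hΦ : IsIsometricTorusAction d N Φ)
    (hψ : ∀ i, IsFlowOf (fun t => Φ (EuclideanSpace.single i t)) (ψ i))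
    (hs : ∀ x, s x = ∑ i, Ω i • ψ i x) {φ : ℝ → M → M} (hφ : IsFlowOf φ s)
    {g : M → ℝ} (hg : ContMDiff (𝓡 d) 𝓘(ℝ, ℝ) ∞ g) (T : ℝ) (x : M) :
    g (φ T x) = g (Φ (T • Ω) x) := by
  let H : EuclideanSpace ℝ (Fin N) × M → ℝ := fun q => g (Φ q.1 q.2)
  have hH : ContMDiff (𝓘(ℝ, EuclideanSpace ℝ (Fin N)).prod (𝓡 d)) 𝓘(ℝ, ℝ) ∞ H :=
    hg.comp hΦ.contMDiff
  have hder : ∀ t : ℝ, HasDerivAt (fun t => H ((T - t) • Ω, φ t x)) 0 t := by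
    intro t
    set q : EuclideanSpace ℝ (Fin N) × M := ((T - t) • Ω, φ t x)
    have hHq : MDifferentiableAt (𝓘(ℝ, EuclideanSpace ℝ (Fin N)).prod (𝓡 d)) 𝓘(ℝ, ℝ) H q :=
      hH.mdifferentiableAt (by simp)
    have h1 : HasDerivAt (fun t : ℝ => (T - t) • Ω) (-Ω) t := by
      simpa using ((hasDerivAt_id t).const_sub T).smul_const Ω
    have h2 := hHq.hasMFDerivAt.comp (f := fun t => ((T - t) • Ω, φ t x)) t
      (h1.hasFDerivAt.hasMFDerivAt.prodMk (hφ.isMIntegralCurve x t))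
    let L : ℝ →L[ℝ] ℝ := (mfderiv (𝓘(ℝ, EuclideanSpace ℝ (Fin N)).prod (𝓡 d)) 𝓘(ℝ, ℝ) H q).comp
      ((ContinuousLinearMap.smulRight (1 : ℝ →L[ℝ] ℝ) (-Ω)).prod
        (ContinuousLinearMap.smulRight (1 : ℝ →L[ℝ] ℝ) (s (φ t x))))
    have h2' : HasFDerivAt (fun t => H ((T - t) • Ω, φ t x)) L t := h2.hasFDerivAt
    refine h2'.hasDerivAt.congr_deriv ?_
    let w : TangentSpace (𝓘(ℝ, EuclideanSpace ℝ (Fin N)).prod (𝓡 d)) q := (-Ω, s (φ t x))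
    have hw : L 1 = mfderiv (𝓘(ℝ, EuclideanSpace ℝ (Fin N)).prod (𝓡 d)) 𝓘(ℝ, ℝ) H q w :=
      congrArg (mfderiv (𝓘(ℝ, EuclideanSpace ℝ (Fin N)).prod (𝓡 d)) 𝓘(ℝ, ℝ) H q)
        (Prod.ext (one_smul ℝ (-Ω)) (one_smul ℝ (s (φ t x))))
    refine hw.trans ((mfderiv_prod_eq_add_apply hHq).trans ?_)
    have h3 : mfderiv (𝓡 d) 𝓘(ℝ, ℝ) (fun z => H (q.1, z)) q.2 (s q.2)
        = fderiv ℝ (fun σ => H (σ, q.2)) q.1 Ω := by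
      have h4 : MDifferentiableAt (𝓡 d) 𝓘(ℝ, ℝ) (fun z => H (q.1, z)) q.2 :=
        (hg.comp (hΦ.contMDiff_map q.1)).mdifferentiableAt (by simp)
      refine (hΦ.lieDerivative_eq_fderiv hψ hs h4).trans ?_
      have h5 : (fun σ => H (q.1, Φ σ q.2)) = fun σ => H (σ + q.1, q.2) := by
        funext σ
        simp only [H, ← hΦ.map_add, add_comm]
      rw [h5, fderiv_comp_add_right (f := fun σ => H (σ, q.2)), zero_add]
    have h6 : mfderiv 𝓘(ℝ, EuclideanSpace ℝ (Fin N)) 𝓘(ℝ, ℝ) (fun z => H (z, q.2)) q.1 (-Ω)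
        = -fderiv ℝ (fun σ => H (σ, q.2)) q.1 Ω := by
      rw [mfderiv_eq_fderiv]
      exact map_neg _ _
    refine (congrArg₂ (· + ·) h6 h3).trans ?_
    exact neg_add_cancel _
  have hconst := is_const_of_deriv_eq_zero (fun t => (hder t).differentiableAt)
    (fun t => (hder t).deriv) T 0
  simpa [H, hΦ.map_zero, hφ.map_zero] using hconst

end IsIsometricTorusAction

end LieDerivative

/-! ### The solution on the manifold -/

section Solution

-- the normalized Haar measure, in terms of which `UnitAddTorus.mFourierCoeff` is defined
noncomputable local instance : MeasureSpace UnitAddCircle := ⟨AddCircle.haarAddCircle⟩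

local instance : Measure.IsAddHaarMeasure (volume : Measure UnitAddCircle) :=
  inferInstanceAs (Measure.IsAddHaarMeasure AddCircle.haarAddCircle)

local instance : IsProbabilityMeasure (volume : Measure UnitAddCircle) :=
  inferInstanceAs (IsProbabilityMeasure AddCircle.haarAddCircle)

variable {d N : ℕ} {M : Type*}

/-- The action with the torus normalized to `ℝᴺ / ℤᴺ`. -/
noncomputable def unitAction (Φ : EuclideanSpace ℝ (Fin N) → M → M) (u : Fin N → ℝ) : M → M :=
  Φ (WithLp.toLp 2 ((2 * π) • u))

/-- The function `J` along the orbit of `x`, as a function on `ℝᴺ`. -/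
noncomputable def orbitFun (Φ : EuclideanSpace ℝ (Fin N) → M → M) (J : M → ℝ) (x : M)
    (u : Fin N → ℝ) : ℂ :=
  J (unitAction Φ u x)

/-- The pairing of the kernel `K` with `smoothingOp L` applied to `J` along the orbit of `x`. For
the kernel of `IsDiophantine.exists_kernel`, the real part of this function of `x` solves
`£_s h = J`. -/
noncomputable def kernelPairing (L : List (Fin N)) (K : C(UnitAddTorus (Fin N), ℂ))
    (Φ : EuclideanSpace ℝ (Fin N) → M → M) (J : M → ℝ) (x : M) : ℂ :=
  ∫ t, K t * torusLift (smoothingOp L (orbitFun Φ J x)) t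

theorem unitAction_smul (Φ : EuclideanSpace ℝ (Fin N) → M → M) (Ω : EuclideanSpace ℝ (Fin N))
    (τ : ℝ) : unitAction Φ (τ • fun i => Ω i / (2 * π)) = Φ (τ • Ω) := by
  unfold unitAction
  congr 1
  ext i
  have := Real.pi_ne_zero
  simp only [Pi.smul_apply, smul_eq_mul, PiLp.smul_apply]
  field_simp

variable [TopologicalSpace M] [ChartedSpace (EuclideanSpace ℝ (Fin d)) M]
  [RiemannianBundle (fun x : M => TangentSpace (𝓡 d) x)]
  {Φ : EuclideanSpace ℝ (Fin N) → M → M} {J : M → ℝ}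

namespace IsIsometricTorusAction

theorem contMDiff_unitAction (hΦ : IsIsometricTorusAction d N Φ) :
    ContMDiff (𝓘(ℝ, Fin N → ℝ).prod (𝓡 d)) (𝓡 d) ∞
      (fun p : (Fin N → ℝ) × M => unitAction Φ p.1 p.2) := by
  have h1 : ContDiff ℝ ∞ fun u : Fin N → ℝ =>
      (WithLp.toLp 2 ((2 * π) • u) : EuclideanSpace ℝ (Fin N)) := by fun_prop
  exact hΦ.contMDiff.comp ((h1.contMDiff.comp contMDiff_fst).prodMk contMDiff_snd)

theorem unitAction_add (hΦ : IsIsometricTorusAction d N Φ) (u v : Fin N → ℝ) (x : M) :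
    unitAction Φ (u + v) x = unitAction Φ u (unitAction Φ v x) := by
  unfold unitAction
  rw [smul_add, WithLp.toLp_add, hΦ.map_add]

theorem orbitFun_unitAction (hΦ : IsIsometricTorusAction d N Φ) (u : Fin N → ℝ) (x : M) :
    orbitFun Φ J (unitAction Φ u x) = fun v => orbitFun Φ J x (v + u) := by
  funext v
  rw [orbitFun, orbitFun, hΦ.unitAction_add]

theorem unitAction_int (hΦ : IsIsometricTorusAction d N Φ) (k : Fin N → ℤ) (x : M) :
    unitAction Φ (fun i => (k i : ℝ)) x = x := by
  -- the periods form a subgroup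
  let P : AddSubgroup (EuclideanSpace ℝ (Fin N)) :=
    { carrier := {σ | ∀ x, Φ σ x = x}
      zero_mem' := hΦ.map_zero
      add_mem' := fun {σ τ} hσ hτ x => by rw [hΦ.map_add, hτ, hσ]
      neg_mem' := fun {σ} hσ x => by
        conv_lhs => rw [← hσ x]
        rw [← hΦ.map_add, neg_add_cancel, hΦ.map_zero] }
  have h1 : (WithLp.toLp 2 ((2 * π) • fun i => (k i : ℝ)) : EuclideanSpace ℝ (Fin N))
      = ∑ i, k i • EuclideanSpace.single i (2 * π) := by
    ext j
    simp [Finset.sum_apply, Pi.single_apply, mul_comm]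
  have h2 : (∑ i, k i • EuclideanSpace.single i (2 * π) : EuclideanSpace ℝ (Fin N)) ∈ P :=
    P.sum_mem fun i _ => P.zsmul_mem (hΦ.periodic i) (k i)
  rw [unitAction, h1]
  exact h2 x

theorem smoothPeriodic_orbitFun (hΦ : IsIsometricTorusAction d N Φ)
    (hJ : ContMDiff (𝓡 d) 𝓘(ℝ, ℝ) ∞ J) (x : M) : SmoothPeriodic (orbitFun Φ J x) where
  contDiff := by
    have h1 : ContMDiff 𝓘(ℝ, Fin N → ℝ) (𝓡 d) ∞ fun u => unitAction Φ u x :=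
      hΦ.contMDiff_unitAction.comp (contMDiff_id.prodMk contMDiff_const)
    exact Complex.ofRealCLM.contDiff.comp (hJ.comp h1).contDiff
  periodic k u := by
    rw [orbitFun, orbitFun, hΦ.unitAction_add, hΦ.unitAction_int]

theorem tangentNormSq_unitAction (hΦ : IsIsometricTorusAction d N Φ) (u : Fin N → ℝ)
    (z : TangentBundle (𝓡 d) M) :
    tangentNormSq (tangentMap (𝓡 d) (𝓡 d) (unitAction Φ u) z) = tangentNormSq z :=
  hΦ.isometry _ z.1 z.2 z.2

/-- The regularity of the pairing: as an integral over `(0, 1]ᴺ`, it is as regular in `x` as the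
integrand. -/
theorem contMDiff_kernelPairing (hΦ : IsIsometricTorusAction d N Φ)
    (hJ : ContMDiff (𝓡 d) 𝓘(ℝ, ℝ) ∞ J) {n : WithTop ℕ∞} (hn : n = ∞ ∨ n = ω)
    [IsManifold (𝓡 d) n M]
    (hfac : ∀ (x₀ : M) (u₀ : Fin N → ℝ), FactorsAt n
      (fun q : (Fin N → ℝ) × EuclideanSpace ℝ (Fin d) =>
        (J (unitAction Φ q.1 ((extChartAt (𝓡 d) x₀).symm q.2)) : ℂ)) u₀ (extChartAt (𝓡 d) x₀ x₀))
    (L : List (Fin N)) (K : C(UnitAddTorus (Fin N), ℂ)) :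
    ContMDiff (𝓡 d) 𝓘(ℝ, ℂ) n (kernelPairing L K Φ J) := by
  intro x₀
  set e := extChartAt (𝓡 d) x₀
  set B : Set (Fin N → ℝ) := {u | ∀ i, u i ∈ Set.Ioc ((0 : Fin N → ℝ) i) ((0 : Fin N → ℝ) i + 1)}
  have hBm : MeasurableSet B := by
    have : B = Set.univ.pi fun _ => Set.Ioc 0 1 := by ext; simp [B]
    rw [this]
    exact MeasurableSet.univ_pi fun _ => measurableSet_Ioc
  have hBS : B ⊆ Set.Icc 0 1 := fun u hu => ⟨fun i => (hu i).1.le, fun i => by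
    simpa using (hu i).2⟩
  have hn1 : n + 1 ≤ n := by rcases hn with rfl | rfl <;> simp
  have h1 : ContDiffAt ℝ n (fun v => ∫ u in B, K (torusMk u) *
      smoothingOp L (orbitFun Φ J (e.symm v)) u) (e x₀) :=
    FactorsAt.contDiffAt_setIntegral (μ := volume) (S := Set.Icc 0 1)
      (f := fun q => smoothingOp L (orbitFun Φ J (e.symm q.2)) q.1) hn isCompact_Icc
      (fun u _ => (hfac x₀ u).smoothingOp hn1 L)
      (fun v => ((hΦ.smoothPeriodic_orbitFun hJ (e.symm v)).smoothingOp L).contDiff.continuous)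
      (K.continuous.comp continuous_torusMk) hBS hBm
  have h2 : ContMDiffAt (𝓡 d) 𝓘(ℝ, ℂ) n (fun x => ∫ u in B, K (torusMk u) *
      smoothingOp L (orbitFun Φ J (e.symm (e x))) u) x₀ :=
    h1.contMDiffAt.comp x₀ (contMDiffAt_extChartAt (n := n))
  refine h2.congr_of_eventuallyEq ?_
  filter_upwards [extChartAt_source_mem_nhds (I := 𝓡 d) x₀] with x hx
  rw [show e.symm (e x) = x from e.left_inv hx, kernelPairing,
    UnitAddTorus.integral_preimage _ (0 : Fin N → ℝ)]
  refine setIntegral_congr_fun hBm fun u _ => ?_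
  exact congrArg (K (torusMk u) * ·)
    (((hΦ.smoothPeriodic_orbitFun hJ x).smoothingOp L).torusLift_mk u)

variable {Ω : EuclideanSpace ℝ (Fin N)}

/-- If the time averages of `J` along `t ↦ Φ (t Ω)` tend to zero, then so does the average of `J`
over every orbit of the torus: the difference of the two is the increment of a bounded primitive,
divided by the time. -/
theorem mFourierCoeff_zero_eq_zero (hΦ : IsIsometricTorusAction d N Φ)
    (hJ : ContMDiff (𝓡 d) 𝓘(ℝ, ℝ) ∞ J) {L : List (Fin N)} {K : C(UnitAddTorus (Fin N), ℂ)}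
    {x : M} (hK : ∀ τ : ℝ, HasDerivAt (fun τ : ℝ => ∫ t, K t * torusLift
        (smoothingOp L fun u => orbitFun Φ J x (u + τ • fun i => Ω i / (2 * π))) t)
      (orbitFun Φ J x (τ • fun i => Ω i / (2 * π))
        - UnitAddTorus.mFourierCoeff (torusLift (orbitFun Φ J x)) 0) τ)
    (havg : Tendsto (fun T : ℝ => (1 / T) * ∫ τ in (0 : ℝ)..T, J (Φ (τ • Ω) x)) atTop (𝓝 0)) :
    UnitAddTorus.mFourierCoeff (torusLift (orbitFun Φ J x)) 0 = 0 := by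
  have hf := hΦ.smoothPeriodic_orbitFun hJ x
  set f := orbitFun Φ J x
  set c := UnitAddTorus.mFourierCoeff (torusLift f) 0
  set w : Fin N → ℝ := fun i => Ω i / (2 * π)
  set I : ℝ → ℂ := fun τ => ∫ t, K t * torusLift (smoothingOp L fun u => f (u + τ • w)) t
  obtain ⟨C, hC⟩ := (hf.smoothingOp L).exists_norm_torusLift_le
  have hI : ∀ τ, ‖I τ‖ ≤ ‖K‖ * C := by
    intro τ
    refine (norm_integral_le_of_norm_le_const (C := ‖K‖ * C) (ae_of_all _ fun t => ?_)).trans_eq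
      (by simp)
    rw [smoothingOp_translate, (hf.smoothingOp L).torusLift_translate, norm_mul]
    exact mul_le_mul (K.norm_coe_le_norm t) (hC _) (norm_nonneg _) (norm_nonneg _)
  have hcont : Continuous fun τ : ℝ => f (τ • w) := hf.contDiff.continuous.comp (by fun_prop)
  have hFTC : ∀ T : ℝ, ∫ τ in (0 : ℝ)..T, f (τ • w) = T * c + (I T - I 0) := by
    intro T
    have h1 := intervalIntegral.integral_eq_sub_of_hasDerivAt (fun τ _ => hK τ)
      ((hcont.sub continuous_const).intervalIntegrable 0 T)
    rw [intervalIntegral.integral_sub (hcont.intervalIntegrable 0 T)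
      intervalIntegrable_const, intervalIntegral.integral_const] at h1
    rw [sub_eq_iff_eq_add] at h1
    rw [h1, sub_zero, Complex.real_smul]
    ring
  have h1 : Tendsto (fun T : ℝ => ((1 / T : ℝ) : ℂ) * ∫ τ in (0 : ℝ)..T, f (τ • w)) atTop
      (𝓝 0) := by
    have h2 := (Complex.continuous_ofReal.tendsto 0).comp havg
    rw [Complex.ofReal_zero] at h2
    refine h2.congr fun T => ?_
    simp only [Function.comp_apply, Complex.ofReal_mul, ← intervalIntegral.integral_ofReal]
    congr 1
    refine intervalIntegral.integral_congr fun τ _ => ?_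
    simp only [f, orbitFun, w, unitAction_smul]
  have h2 : Tendsto (fun T : ℝ => ((1 / T : ℝ) : ℂ) * (I T - I 0)) atTop (𝓝 0) := by
    refine squeeze_zero_norm' (a := fun T : ℝ => (1 / T) * (‖K‖ * C + ‖K‖ * C)) ?_ ?_
    · filter_upwards [eventually_gt_atTop 0] with T hT
      rw [norm_mul, Complex.norm_real, Real.norm_of_nonneg (by positivity)]
      gcongr
      exact (norm_sub_le _ _).trans (add_le_add (hI T) (hI 0))
    · simpa using (tendsto_const_nhds.div_atTop tendsto_id :
        Tendsto (fun T : ℝ => (1 : ℝ) / T) atTop (𝓝 0)).mul_const (‖K‖ * C + ‖K‖ * C)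
  have h3 : Tendsto (fun T : ℝ => ((1 / T : ℝ) : ℂ) * ∫ τ in (0 : ℝ)..T, f (τ • w)) atTop
      (𝓝 (c + 0)) := by
    refine (h2.const_add c).congr' ?_
    filter_upwards [eventually_gt_atTop 0] with T hT
    rw [hFTC, mul_add, ← mul_assoc, ← Complex.ofReal_mul, one_div_mul_cancel hT.ne',
      Complex.ofReal_one, one_mul]
  simpa using tendsto_nhds_unique h3 h1

theorem hasDerivAt_kernelPairing (hΦ : IsIsometricTorusAction d N Φ)
    {L : List (Fin N)} {K : C(UnitAddTorus (Fin N), ℂ)}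
    {x : M} (hK : HasDerivAt (fun τ : ℝ => ∫ t, K t * torusLift
        (smoothingOp L fun u => orbitFun Φ J x (u + τ • fun i => Ω i / (2 * π))) t) (J x : ℂ) 0) :
    HasDerivAt (fun τ : ℝ => (kernelPairing L K Φ J (Φ (τ • Ω) x)).re) (J x) 0 := by
  have h1 : (fun τ : ℝ => kernelPairing L K Φ J (Φ (τ • Ω) x)) = fun τ : ℝ => ∫ t, K t * torusLift
      (smoothingOp L fun u => orbitFun Φ J x (u + τ • fun i => Ω i / (2 * π))) t := by
    funext τ
    rw [← unitAction_smul Φ, kernelPairing, hΦ.orbitFun_unitAction]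
  rw [← h1] at hK
  exact Complex.reCLM.hasFDerivAt.comp_hasDerivAt (0 : ℝ) hK

end IsIsometricTorusAction

end Solution

theorem lemma1 {d N : ℕ} {M : Type*} [TopologicalSpace M] [T2Space M] [CompactSpace M]
    [ChartedSpace (EuclideanSpace ℝ (Fin d)) M] [IsManifold (𝓡 d) ∞ M]
    [RiemannianBundle (fun x : M => TangentSpace (𝓡 d) x)]
    [IsContMDiffRiemannianBundle (𝓡 d) ∞ (EuclideanSpace ℝ (Fin d))
      (fun x : M => TangentSpace (𝓡 d) x)]
    -- an isometric action of the torus, with generating Killing fields `ψ i`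
    (Φ : EuclideanSpace ℝ (Fin N) → M → M) (hΦ : IsIsometricTorusAction d N Φ)
    (ψ : Fin N → ∀ x : M, TangentSpace (𝓡 d) x)
    (hψ : ∀ i, IsFlowOf (fun t => Φ (EuclideanSpace.single i t)) (ψ i))
    -- the Killing field `s = ∑ Ωᵢ ψᵢ` and its flow
    (Ω : EuclideanSpace ℝ (Fin N)) (hΩ : IsDiophantine Ω)
    (s : ∀ x : M, TangentSpace (𝓡 d) x) (hs : ∀ x, s x = ∑ i, Ω i • ψ i x)
    (φ : ℝ → M → M) (hφ : IsFlowOf φ s)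
    -- a smooth function with vanishing time averages along the flow
    (J : M → ℝ) (hJ : ContMDiff (𝓡 d) 𝓘(ℝ, ℝ) ∞ J)
    (hJ_avg : ∀ x, Tendsto (fun T : ℝ => (1 / T) * ∫ τ in (0 : ℝ)..T, J (φ τ x)) atTop (𝓝 0)) :
    (∃ h : M → ℝ, ContMDiff (𝓡 d) 𝓘(ℝ, ℝ) ∞ h ∧ ∀ x, lieDerivative s h x = J x) ∧
    -- the real analytic case: the manifold, its metric and `J` are real analytic
    (IsManifold (𝓡 d) ω M →
      IsContMDiffRiemannianBundle (𝓡 d) ω (EuclideanSpace ℝ (Fin d))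
        (fun x : M => TangentSpace (𝓡 d) x) →
      ContMDiff (𝓡 d) 𝓘(ℝ, ℝ) ω J →
      ∃ h : M → ℝ, ContMDiff (𝓡 d) 𝓘(ℝ, ℝ) ω h ∧ ∀ x, lieDerivative s h x = J x) := by
  obtain ⟨L, K, hK⟩ := hΩ.exists_kernel
  have hf := hΦ.smoothPeriodic_orbitFun hJ
  have hmean : ∀ x, UnitAddTorus.mFourierCoeff (torusLift (orbitFun Φ J x)) 0 = 0 := fun x =>
    hΦ.mFourierCoeff_zero_eq_zero hJ (hK _ (hf x)) (by
      simpa only [hΦ.comp_flow_eq hψ hs hφ hJ] using hJ_avg x)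
  have hsolves : ∀ n : WithTop ℕ∞, n ≠ 0 →
      ContMDiff (𝓡 d) 𝓘(ℝ, ℂ) n (kernelPairing L K Φ J) →
      ContMDiff (𝓡 d) 𝓘(ℝ, ℝ) n (fun x => (kernelPairing L K Φ J x).re) ∧
      ∀ x, lieDerivative s (fun x => (kernelPairing L K Φ J x).re) x = J x := by
    intro n hn hreg
    have hre : ContMDiff (𝓡 d) 𝓘(ℝ, ℝ) n (fun x => (kernelPairing L K Φ J x).re) :=
      Complex.reCLM.contDiff.contMDiff.comp hreg
    refine ⟨hre, fun x => ?_⟩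
    rw [hΦ.lieDerivative_eq_fderiv hψ hs (hre.mdifferentiableAt hn)]
    have h1 := hK _ (hf x) 0
    have h3 : orbitFun Φ J x ((0 : ℝ) • fun i => Ω i / (2 * π)) = J x := by
      rw [orbitFun, unitAction_smul, zero_smul, hΦ.map_zero]
    rw [hmean, sub_zero, h3] at h1
    have h2 := hΦ.hasDerivAt_kernelPairing h1
    have h5 : DifferentiableAt ℝ (fun σ => (kernelPairing L K Φ J (Φ σ x)).re) 0 := by
      refine MDifferentiableAt.differentiableAt ?_
      exact MDifferentiableAt.comp (I' := 𝓡 d)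
        (g := fun y => (kernelPairing L K Φ J y).re) (f := fun σ => Φ σ x) 0
        (hre.mdifferentiableAt hn) ((hΦ.contMDiff_orbit x).mdifferentiableAt (by simp))
    have h6 : HasDerivAt (fun τ : ℝ => τ • Ω) Ω 0 := by
      simpa using (hasDerivAt_id (0 : ℝ)).smul_const Ω
    have h7 : HasDerivAt (fun τ : ℝ => (kernelPairing L K Φ J (Φ (τ • Ω) x)).re)
        (fderiv ℝ (fun σ => (kernelPairing L K Φ J (Φ σ x)).re) 0 Ω) 0 :=
      HasFDerivAt.comp_hasDerivAt (l := fun σ => (kernelPairing L K Φ J (Φ σ x)).re) 0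
        (by rw [zero_smul]; exact h5.hasFDerivAt) h6
    exact h7.unique h2
  refine ⟨⟨_, hsolves ∞ (by simp) (hΦ.contMDiff_kernelPairing hJ (Or.inl rfl)
    (factorsAt_smooth_action hΦ.contMDiff_unitAction hJ) L K)⟩, fun _ _ hJω => ⟨_, hsolves ω
    (by simp) (hΦ.contMDiff_kernelPairing hJ (Or.inr rfl) (factorsAt_isometric_action
      hΦ.contMDiff_unitAction hΦ.tangentNormSq_unitAction hJω) L K)⟩⟩
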